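/- Let $I=[c,d]$, let $1\le p<\infty$, let $k\ge 0$ be an integer, and let $W^{k,p}(I)$ be the real Sobolev space with norm $\|g\|_{W^{k,p}}=\big(\sum_{j=0}^{k}\|D^jg\|_p^p\big)^{1/p}$. Let $c=x_1<x_2<\dots<x_N=d$ with $N\ge 3$. For $1\le i\le N-1$ put $I_i=[x_i,x_{i+1}]$, $a_i=(x_{i+1}-x_i)/(d-c)$, and let $L_i(t)=x_i+a_i(t-c)$ be the increasing affine map of $I$ onto $I_i$. Let $L:W^{k,p}(I)\to W^{k,p}(I)$ be a bounded linear operator such that for every $f\in W^{k,p}(I)$ and every integer $0\le r<k$ $$(Lf)^{(r)}(c)=f^{(r)}(c),\qquad (Lf)^{(r)}(d)=f^{(r)}(d)$$ (values of the continuous representatives; no condition if $k=0$). Let $\alpha=(\alpha_1,\dots,\alpha_{N-1})\in\mathbb R^{N-1}$ satisfy $$\Big[\sum_{i=1}^{N-1}\frac{|\alpha_i|^p}{a_i^{kp-1}}\Big]^{1/p}<\big(1+\|I_d-L\|\big)^{-1},$$ where $I_d$ is the identity and $\|\cdot\|$ the operator norm on $W^{k,p}(I)$. Then: (1) For every $f\in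 W^{k,p}(I)$ there is exactly one $f^\alpha\in W^{k,p}(I)$ satisfying the self-referential equation $$f^\alpha(x)=f(x)+\alpha_i\,(f^\alpha-Lf)\big(L_i^{-1}(x)\big)\quad\text{for a.e. }x\in I_i,\ 1\le i\le N-1,$$ and the $\alpha$-fractal operator $\mathcal F^\alpha: f\mapsto f^\alpha$ is a topological automorphism of $W^{k,p}(I)$ (a bounded linear bijection with bounded inverse). (2) For every Schauder basis $(f_m)$ of $W^{k,p}(I)$, the sequence $(f_m^\alpha)$ is a Schauder basis of $W^{k,p}(I)$. (3) Schauder bases of $W^{k,p}(I)$ exist; consequently $W^{k,p}(I)$ has a Schauder basis consisting of self-referential functions $f_m^\alpha$ as in (1), where $(f_m)$ is itself a Schauder basis. -/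

import Mathlib

open MeasureTheory Set
open scoped ENNReal

/-- Lebesgue measure on the compact interval `I = [c, d]`. -/
noncomputable abbrev intervalMeasure (c d : ℝ) : Measure ℝ := volume.restrict (Icc c d)

/-- The real Lebesgue space `L^p([c, d])`. -/
abbrev IntervalLp (p : ℝ≥0∞) (c d : ℝ) : Type := Lp ℝ p (intervalMeasure c d)

/-- `v` is the `j`-th weak derivative of `u` on `[c, d]`:
`∫ u φ⁽ʲ⁾ = (-1)ʲ ∫ v φ` for all smooth `φ` with compact support in the open interval `(c, d)`. -/
def IsWeakDeriv (c d : ℝ) (j : ℕ) (u v : ℝ → ℝ) : Prop :=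
  ∀ φ : ℝ → ℝ, ContDiff ℝ (⊤ : ℕ∞) φ → HasCompactSupport φ → tsupport φ ⊆ Ioo c d →
    ∫ t in Icc c d, u t * iteratedDeriv j φ t = (-1) ^ j * ∫ t in Icc c d, v t * φ t

/-- An `L^p` function on a bounded interval is integrable against a continuous function with
compact support. -/
theorem IntervalLp.integrable_mul {p : ℝ≥0∞} [Fact (1 ≤ p)] {c d : ℝ} (u : IntervalLp p c d)
    {ψ : ℝ → ℝ} (hψ : Continuous ψ) (hc : HasCompactSupport ψ) :
    Integrable (fun t => u t * ψ t) (intervalMeasure c d) := by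
  have hu : Integrable u (intervalMeasure c d) := (Lp.memLp u).integrable Fact.out
  obtain ⟨C, hC⟩ := hψ.bounded_above_of_compact_support hc
  exact hu.mul_bdd (c := C) hψ.aestronglyMeasurable (Filter.Eventually.of_forall hC)

theorem continuous_iteratedDeriv_of_smooth {φ : ℝ → ℝ} (hφ : ContDiff ℝ (⊤ : ℕ∞) φ) (j : ℕ) :
    Continuous (iteratedDeriv j φ) :=
  hφ.continuous_iteratedDeriv j (by exact_mod_cast le_top)

theorem hasCompactSupport_iteratedDeriv {φ : ℝ → ℝ} (hφ : HasCompactSupport φ) (j : ℕ) :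
    HasCompactSupport (iteratedDeriv j φ) := by
  induction j with
  | zero => simpa using hφ
  | succ j ih => rw [iteratedDeriv_succ]; exact ih.deriv

/-- The tuples `(u_0, …, u_k)` in `L^p([c, d])` such that `u_j` is the `j`-th weak derivative of
`u_0` for every `j ≤ k`. -/
noncomputable def sobolevSubmodule (k : ℕ) (p : ℝ≥0∞) [Fact (1 ≤ p)] (c d : ℝ) :
    Submodule ℝ (PiLp p (fun _ : Fin (k + 1) => IntervalLp p c d)) where
  carrier := {u | ∀ j : Fin (k + 1), IsWeakDeriv c d j (u 0) (u j)}
  zero_mem' := by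
    intro j φ _ _ _
    have key : ∀ (i : Fin (k + 1)) (ψ : ℝ → ℝ),
        ∫ t in Icc c d, ((0 : PiLp p (fun _ : Fin (k + 1) => IntervalLp p c d)) i) t * ψ t = 0 := by
      intro i ψ
      apply integral_eq_zero_of_ae
      filter_upwards [Lp.coeFn_zero ℝ p (intervalMeasure c d)] with t ht
      rw [PiLp.zero_apply, ht, Pi.zero_apply, zero_mul]
    rw [key, key, mul_zero]
  add_mem' := by
    intro u v hu hv j φ h1 h2 h3
    have key : ∀ (i : Fin (k + 1)) (ψ : ℝ → ℝ), Continuous ψ → HasCompactSupport ψ →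
        ∫ t in Icc c d, ((u + v) i) t * ψ t
          = (∫ t in Icc c d, (u i) t * ψ t) + ∫ t in Icc c d, (v i) t * ψ t := by
      intro i ψ hψ hc
      rw [← integral_add (IntervalLp.integrable_mul _ hψ hc) (IntervalLp.integrable_mul _ hψ hc)]
      apply integral_congr_ae
      filter_upwards [Lp.coeFn_add (u i) (v i)] with t ht
      rw [PiLp.add_apply, ht, Pi.add_apply, add_mul]
    rw [key 0 _ (continuous_iteratedDeriv_of_smooth h1 j) (hasCompactSupport_iteratedDeriv h2 j),
      key j _ h1.continuous h2, hu j φ h1 h2 h3, hv j φ h1 h2 h3]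
    ring
  smul_mem' := by
    intro a u hu j φ h1 h2 h3
    have key : ∀ (i : Fin (k + 1)) (ψ : ℝ → ℝ),
        ∫ t in Icc c d, ((a • u) i) t * ψ t = a * ∫ t in Icc c d, (u i) t * ψ t := by
      intro i ψ
      rw [← integral_const_mul]
      apply integral_congr_ae
      filter_upwards [Lp.coeFn_smul a (u i)] with t ht
      rw [PiLp.smul_apply, ht, Pi.smul_apply, smul_eq_mul, mul_assoc]
    rw [key, key, hu j φ h1 h2 h3]
    ring

/-- The Sobolev space `W^{k,p}([c, d])`. A Sobolev function `g` is recorded together with its weak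
derivatives, as the tuple `(g, D g, …, D^k g)` of elements of `L^p([c, d])`; the tuple is determined
by `g` (`SobolevSpace.ext_toLp`). The norm inherited from the `ℓ^p`-product is, for `p < ∞`,
`(∑_{j ≤ k} ‖D^j g‖_p^p)^{1/p}` (`SobolevSpace.norm_eq`). -/
abbrev SobolevSpace (k : ℕ) (p : ℝ≥0∞) [Fact (1 ≤ p)] (c d : ℝ) : Type :=
  sobolevSubmodule k p c d

namespace SobolevSpace

/-- The `j`-th weak derivative `D^j u ∈ L^p([c, d])` of a Sobolev function, `0 ≤ j ≤ k`. -/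
noncomputable def wderiv {k : ℕ} {p : ℝ≥0∞} [Fact (1 ≤ p)] {c d : ℝ}
    (u : SobolevSpace k p c d) (j : Fin (k + 1)) : IntervalLp p c d :=
  (u : PiLp p (fun _ : Fin (k + 1) => IntervalLp p c d)) j

/-- The Sobolev function itself, as an element of `L^p([c, d])`. -/
noncomputable def toLp {k : ℕ} {p : ℝ≥0∞} [Fact (1 ≤ p)] {c d : ℝ}
    (u : SobolevSpace k p c d) : IntervalLp p c d :=
  u.wderiv 0

/-- A Sobolev function is determined by its class in `L^p`: weak derivatives are unique. -/
theorem ext_toLp {k : ℕ} {p : ℝ≥0∞} [Fact (1 ≤ p)] {c d : ℝ}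
    {u v : SobolevSpace k p c d} (h : u.toLp = v.toLp) : u = v := by
  apply Subtype.ext
  apply PiLp.ext
  intro j
  have hI : ∀ w : IntervalLp p c d, IntegrableOn w (Icc c d) volume :=
    fun w => (Lp.memLp w).integrable Fact.out
  have h0 : u.1 0 = v.1 0 := h
  have hz : ∀ᵐ t ∂(volume : Measure ℝ), t ∈ Ioo c d → (u.1 j - v.1 j : ℝ → ℝ) t = 0 := by
    refine isOpen_Ioo.ae_eq_zero_of_integral_contDiff_smul_eq_zero ?_ ?_
    · exact (((hI (u.1 j)).sub (hI (v.1 j))).mono_set Ioo_subset_Icc_self).locallyIntegrableOn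
    · intro φ h1 h2 h3
      have hzero : ∀ t, t ∉ Icc c d → φ t • (u.1 j - v.1 j : ℝ → ℝ) t = 0 := by
        intro t ht
        rw [image_eq_zero_of_notMem_tsupport (fun hh => ht (Ioo_subset_Icc_self (h3 hh))), zero_smul]
      rw [← setIntegral_eq_integral_of_forall_compl_eq_zero hzero]
      have e1 := u.2 j φ h1 h2 h3
      have e2 := v.2 j φ h1 h2 h3
      rw [h0] at e1
      have e3 := mul_left_cancel₀ (pow_ne_zero _ (by norm_num)) (e1.symm.trans e2)
      have e4 := integral_sub (IntervalLp.integrable_mul (u.1 j) h1.continuous h2)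
        (IntervalLp.integrable_mul (v.1 j) h1.continuous h2)
      rw [e3, sub_self] at e4
      rw [← e4]
      congr 1
      funext t
      simp only [Pi.sub_apply, smul_eq_mul]
      ring
  apply Lp.ext
  have hz' : ∀ᵐ t ∂(volume.restrict (Ioo c d)), (u.1 j - v.1 j : ℝ → ℝ) t = 0 :=
    (ae_restrict_iff' measurableSet_Ioo).2 hz
  rw [Measure.restrict_congr_set Ioo_ae_eq_Icc] at hz'
  filter_upwards [hz'] with t ht
  exact sub_eq_zero.1 ht

/-- The norm of `W^{k,p}([c, d])` for `1 ≤ p < ∞`. -/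
theorem norm_eq {k : ℕ} {p : ℝ≥0∞} [Fact (1 ≤ p)] (hp : p ≠ ⊤) {c d : ℝ}
    (u : SobolevSpace k p c d) :
    ‖u‖ = (∑ j : Fin (k + 1), ‖u.wderiv j‖ ^ p.toReal) ^ (1 / p.toReal) :=
  PiLp.norm_eq_sum (ENNReal.toReal_pos (zero_lt_one.trans_le (Fact.out : 1 ≤ p)).ne' hp) u.1

/-- `u` and `v` have the same boundary values up to order `k - 1`: for all `r < k` the continuous
representatives `h` of `D^r u` and `h'` of `D^r v` on `[c, d]` agree at `c` and at `d`. (For `r < k`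
such representatives exist, and if `c < d` they are unique on `[c, d]`; for `k = 0` nothing is
required.) -/
def EqAtEndpoints {k : ℕ} {p : ℝ≥0∞} [Fact (1 ≤ p)] {c d : ℝ}
    (u v : SobolevSpace k p c d) : Prop :=
  ∀ r : Fin k, ∃ h h' : ℝ → ℝ, ContinuousOn h (Icc c d) ∧ ContinuousOn h' (Icc c d) ∧
    u.wderiv r.castSucc =ᵐ[intervalMeasure c d] h ∧
    v.wderiv r.castSucc =ᵐ[intervalMeasure c d] h' ∧ h c = h' c ∧ h d = h' d

end SobolevSpace

/-- A partition `c = x_0 < x_1 < ⋯ < x_n = d` of `[c, d]` into `n` subintervals. -/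
structure IntervalPartition (c d : ℝ) (n : ℕ) where
  knot : Fin (n + 1) → ℝ
  strictMono : StrictMono knot
  first : knot 0 = c
  last : knot (Fin.last n) = d

namespace IntervalPartition

/-- The `i`-th subinterval (closed; the common endpoints form a null set). -/
def piece {c d : ℝ} {n : ℕ} (P : IntervalPartition c d n) (i : Fin n) : Set ℝ :=
  Icc (P.knot i.castSucc) (P.knot i.succ)

/-- The slope `a_i` of the increasing affine map `L_i` from `[c, d]` onto the `i`-th subinterval. -/
noncomputable def slope {c d : ℝ} {n : ℕ} (P : IntervalPartition c d n) (i : Fin n) : ℝ :=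
  (P.knot i.succ - P.knot i.castSucc) / (d - c)

/-- The inverse of the affine map `L_i t = x_i + a_i (t - c)` from `[c, d]` onto the `i`-th
subinterval. -/
noncomputable def affineInv {c d : ℝ} {n : ℕ} (P : IntervalPartition c d n) (i : Fin n) (t : ℝ) :
    ℝ :=
  c + (t - P.knot i.castSucc) / P.slope i

/-- The constant `K = (∑ i, |α_i|^p / a_i^(k p - 1))^(1/p)`. -/
noncomputable def scaleConst {c d : ℝ} {n : ℕ} (P : IntervalPartition c d n) (k : ℕ) (p : ℝ≥0∞)
    (α : Fin n → ℝ) : ℝ :=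
  (∑ i, |α i| ^ p.toReal / P.slope i ^ ((k : ℝ) * p.toReal - 1)) ^ (1 / p.toReal)

end IntervalPartition

/-- `g` is an `α`-fractal function of `f` with base function `b`: it is a fixed point of the
Read–Bajraktarević operator, i.e. it satisfies the self-referential equation
`g = f + α_i (g - b) ∘ L_i⁻¹` almost everywhere on the `i`-th subinterval, for every `i`. -/
def IsAlphaFractal {k : ℕ} {p : ℝ≥0∞} [Fact (1 ≤ p)] {c d : ℝ} {n : ℕ}
    (P : IntervalPartition c d n) (α : Fin n → ℝ) (f b g : SobolevSpace k p c d) : Prop :=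
  ∀ i : Fin n, ∀ᵐ t ∂(volume.restrict (P.piece i)),
    g.toLp t = f.toLp t + α i * (g.toLp (P.affineInv i t) - b.toLp (P.affineInv i t))

/-! Write `D = Id - L` and let `S` send a tuple `(v_j)` to the tuple whose `j`-th entry is `α_i
a_i^{-j} v_j ∘ L_i⁻¹` on the `i`-th piece (`glueTuple`). The self-referential equation reads `g = f
+ S (g - L f)`. With `w = g - L f` it becomes `w = D f + S w`, so `w = R (D f)` with `R = (1 - S)⁻¹`
and `g = f + B f`, where `B = S R D`.

A change of variables gives the `j`-th component of `S` the `L^p` norm bound `(∑ |α_i|^p / a_i^(j p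
- 1))^(1/p)`. As `a_i ≤ 1`, this is largest for `j = k`, whence `‖S‖ ≤ K = scaleConst`. Then `‖B‖ ≤
K ‖D‖ / (1 - K)`, which is less than `1` exactly when `K (1 + ‖D‖) < 1`, and `1 + B` is invertible
by a Neumann series. Uniqueness of `g` only needs the contraction in `L^p`.

It remains to see that `S R` keeps `D f` inside the Sobolev space. Gluing creates jumps unless the
boundary values vanish, so one works in the closed subspace `sobolevZeroSubmodule`, defined by
testing against all smooth functions, without support condition. It contains `D f` because `L f` and
`f` share their boundary values (`EqAtEndpoints.sub_mem`), it is `S`-invariant by the chain rule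
(`glueTuple_mem`), and it is `R`-invariant by closedness.

An isomorphism carries Schauder bases to Schauder bases. Existence of one is proved by induction on
`k`: the Haar system is a basis of `L^p`, and differentiation maps `W^{k+1,p}` onto `W^{k,p}` with
the constants as kernel, so a basis lifts after adding one vector. -/

/-! ### Constructions of Schauder bases -/

open Filter Topology in
/-- The image of a Schauder basis under a continuous linear equivalence. -/
noncomputable def SchauderBasis.mapEquiv {X Y : Type*} [NormedAddCommGroup X] [NormedSpace ℝ X]
    [NormedAddCommGroup Y] [NormedSpace ℝ Y] (e : SchauderBasis ℝ X) (F : X ≃L[ℝ] Y) :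
    SchauderBasis ℝ Y where
  basis m := F (e m)
  coord m := (e.coord m).comp (F.symm : Y →L[ℝ] X)
  ortho i j := by simpa using e.ortho i j
  expansion y := by
    simpa using (e.expansion (F.symm y)).mapL (F : X →L[ℝ] Y)

open Filter Topology in
/-- If `T : X → Y` is a bounded surjection of Banach spaces whose kernel is a line, then a Schauder
basis of `Y` lifts to one of `X`. -/
theorem SchauderBasis.exists_of_surjective {X Y : Type*} [NormedAddCommGroup X] [NormedSpace ℝ X]
    [CompleteSpace X] [NormedAddCommGroup Y] [NormedSpace ℝ Y] [CompleteSpace Y]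
    (b : SchauderBasis ℝ Y) (T : X →L[ℝ] Y) (hT : Function.Surjective T) {e : X} (he : e ≠ 0)
    (hTe : T e = 0) (hker : ∀ x, T x = 0 → ∃ a : ℝ, x = a • e) :
    Nonempty (SchauderBasis ℝ X) := by
  -- `φ` splits off the kernel line: `(φ, T)` is a bijection onto `ℝ × Y`, hence an isomorphism by
  -- the open mapping theorem. Below, `R` is the right inverse of `T` with values in `ker φ`.
  obtain ⟨φ, hφ⟩ : ∃ φ : StrongDual ℝ X, φ e = 1 := SeparatingDual.exists_eq_one he
  let Φ : X →L[ℝ] ℝ × Y := φ.prod T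
  have hinj : Φ.ker = ⊥ := by
    rw [LinearMap.ker_eq_bot']
    intro x hx
    obtain ⟨h1, h2⟩ := Prod.mk.inj hx
    obtain ⟨a, rfl⟩ := hker x h2
    have : a = 0 := by simpa [hφ] using h1
    simp [this]
  have hsurj : Φ.range = ⊤ := by
    rw [LinearMap.range_eq_top]
    rintro ⟨a, y⟩
    obtain ⟨x, rfl⟩ := hT y
    refine ⟨x + (a - φ x) • e, Prod.ext ?_ ?_⟩ <;> simp [Φ, hφ, hTe]
  let E : X ≃L[ℝ] ℝ × Y := ContinuousLinearEquiv.ofBijective Φ hinj hsurj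
  have hE : ∀ x, E x = (φ x, T x) := fun x => rfl
  let R : Y →L[ℝ] X := (E.symm : ℝ × Y →L[ℝ] X).comp (ContinuousLinearMap.inr ℝ ℝ Y)
  have hR : ∀ y, E (R y) = (0, y) := fun y => by simp [R]
  have hφR : ∀ y, φ (R y) = 0 := fun y => congrArg Prod.fst (hR y)
  have hTR : ∀ y, T (R y) = y := fun y => congrArg Prod.snd (hR y)
  have hdec : ∀ x, R (T x) = x - φ x • e := fun x => by
    apply E.injective
    rw [hR, hE]
    simp [hφ, hTe]
  refine ⟨{ basis := fun n => Nat.casesOn n e (fun m => R (b m))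
            coord := fun n => Nat.casesOn n φ (fun m => (b.coord m).comp T)
            ortho := ?_
            expansion := ?_ }⟩
  · rintro (_ | i) (_ | j)
    · simp [hφ]
    · simp [hφR]
    · simp [hTe]
    · change b.coord i (T (R (b j))) = _
      rw [hTR, b.ortho]
      simp [Pi.single_apply]
  · intro x
    -- Partial sums are shifted by one, so that the term `φ x • e` splits off and the rest is `R` of
    -- a partial sum for `T x`.
    rw [HasSum, SummationFilter.conditional_filter_eq_map_range, tendsto_map'_iff,
      ← tendsto_add_atTop_iff_nat 1]
    have h1 := (b.expansion (T x))
    rw [HasSum, SummationFilter.conditional_filter_eq_map_range, tendsto_map'_iff] at h1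
    have h2 := ((R.continuous.tendsto _).comp h1).add_const (φ x • e)
    rw [hdec, sub_add_cancel] at h2
    refine h2.congr fun n => ?_
    simp [Finset.sum_range_succ', map_sum]

open Filter Topology in
/-- A biorthogonal system with uniformly bounded partial sum operators which converge to the
identity on a dense set is a Schauder basis. -/
theorem SchauderBasis.exists_of_dense {X : Type*} [NormedAddCommGroup X] [NormedSpace ℝ X]
    (e : ℕ → X) (f : ℕ → StrongDual ℝ X)
    (ho : ∀ i j, f i (e j) = if i = j then 1 else 0) {C : ℝ}
    (hC : ∀ n x, ‖∑ i ∈ Finset.range n, f i x • e i‖ ≤ C * ‖x‖) {D : Set X} (hD : Dense D)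
    (hlim : ∀ x ∈ D, Tendsto (fun n => ∑ i ∈ Finset.range n, f i x • e i) atTop (𝓝 x)) :
    Nonempty (SchauderBasis ℝ X) := by
  refine ⟨{ basis := e
            coord := f
            ortho := fun i j => by simp [ho, Pi.single_apply]
            expansion := fun x => ?_ }⟩
  rw [HasSum, SummationFilter.conditional_filter_eq_map_range, tendsto_map'_iff]
  change Tendsto (fun n => ∑ i ∈ Finset.range n, f i x • e i) atTop (𝓝 x)
  rw [Metric.tendsto_atTop]
  intro ε hε
  -- The error splits into three parts, weighted `|C|`, `1` and `1`; hence the denominator `|C| +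
  -- 2`.
  obtain ⟨y, hy, hxy⟩ := hD.exists_dist_lt x (ε := ε / (|C| + 2)) (by positivity)
  obtain ⟨N, hN⟩ := Metric.tendsto_atTop.1 (hlim y hy) (ε / (|C| + 2)) (by positivity)
  refine ⟨N, fun n hn => ?_⟩
  have h1 := hC n (x - y)
  simp only [map_sub, sub_smul, Finset.sum_sub_distrib] at h1
  have h2 := hN n hn
  rw [dist_eq_norm] at *
  set A := ∑ i ∈ Finset.range n, f i x • e i
  set B := ∑ i ∈ Finset.range n, f i y • e i
  calc ‖A - x‖ = ‖(A - B) + (B - y) - (x - y)‖ := by congr 1; abel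
    _ ≤ ‖A - B‖ + ‖B - y‖ + ‖x - y‖ := (norm_sub_le _ _).trans (by gcongr; exact norm_add_le _ _)
    _ ≤ |C| * ‖x - y‖ + ‖B - y‖ + ‖x - y‖ := by
        gcongr; exact h1.trans (by gcongr; exact le_abs_self C)
    _ < |C| * (ε / (|C| + 2)) + ε / (|C| + 2) + ε / (|C| + 2) := by
        have : |C| * ‖x - y‖ ≤ |C| * (ε / (|C| + 2)) := by gcongr
        linarith
    _ = ε := by field_simp; ring

/-! ### Pairing `L^p` with bounded functions -/

section Pairing

variable {p : ℝ≥0∞} [Fact (1 ≤ p)] {c d : ℝ}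

theorem IntervalLp.integrable (u : IntervalLp p c d) : Integrable u (intervalMeasure c d) :=
  (Lp.memLp u).integrable Fact.out

theorem IntervalLp.integrable_mul_of_bdd (u : IntervalLp p c d) {ψ : ℝ → ℝ} {C : ℝ}
    (hψ : AEStronglyMeasurable ψ (intervalMeasure c d))
    (hC : ∀ᵐ t ∂(intervalMeasure c d), ‖ψ t‖ ≤ C) :
    Integrable (fun t => u t * ψ t) (intervalMeasure c d) :=
  u.integrable.mul_bdd hψ hC

/-- Hölder's inequality on a set of finite measure. For `p = ⊤` the convention `1 / 0 = 0` gives the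
right exponent. -/
theorem IntervalLp.exists_integral_norm_le (p : ℝ≥0∞) [Fact (1 ≤ p)] (c d : ℝ) :
    ∃ M : ℝ, 0 ≤ M ∧ ∀ u : IntervalLp p c d, ∫ t in Icc c d, ‖u t‖ ≤ M * ‖u‖ := by
  set κ : ℝ≥0∞ := intervalMeasure c d univ ^ (1 / (1 : ℝ≥0∞).toReal - 1 / p.toReal) with hκ
  have hκtop : κ ≠ ⊤ := by
    refine ENNReal.rpow_ne_top_of_nonneg ?_ (measure_ne_top _ _)
    rcases eq_or_ne p ⊤ with rfl | hp
    · simp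
    · have : 1 ≤ p.toReal := by
        rw [← ENNReal.toReal_one]
        exact ENNReal.toReal_mono hp Fact.out
      rw [ENNReal.toReal_one, sub_nonneg]
      gcongr
  refine ⟨κ.toReal, ENNReal.toReal_nonneg, fun u => ?_⟩
  have h := eLpNorm_le_eLpNorm_mul_rpow_measure_univ (p := 1) (q := p)
    (μ := intervalMeasure c d) Fact.out (Lp.aestronglyMeasurable u)
  rw [integral_norm_eq_lintegral_enorm u.integrable.1, ← eLpNorm_one_eq_lintegral_enorm,
    Lp.norm_def, mul_comm, ← ENNReal.toReal_mul]
  exact ENNReal.toReal_mono (ENNReal.mul_ne_top (Lp.eLpNorm_ne_top u) hκtop) h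

/-- Integration against a bounded function, as a bounded functional on `L^p([c, d])`. -/
theorem IntervalLp.exists_pairing {ψ : ℝ → ℝ} {C : ℝ}
    (hψ : AEStronglyMeasurable ψ (intervalMeasure c d))
    (hC : ∀ᵐ t ∂(intervalMeasure c d), ‖ψ t‖ ≤ C) :
    ∃ Λ : StrongDual ℝ (IntervalLp p c d), ∀ u, Λ u = ∫ t in Icc c d, u t * ψ t := by
  obtain ⟨M, hM0, hM⟩ := IntervalLp.exists_integral_norm_le p c d
  refine ⟨LinearMap.mkContinuous
    { toFun := fun u => ∫ t in Icc c d, u t * ψ t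
      map_add' := fun u v => ?_
      map_smul' := fun a u => ?_ } (|C| * M) fun u => ?_, fun u => rfl⟩
  · rw [← integral_add (u.integrable_mul_of_bdd hψ hC) (v.integrable_mul_of_bdd hψ hC)]
    apply integral_congr_ae
    filter_upwards [Lp.coeFn_add u v] with t ht
    rw [ht, Pi.add_apply, add_mul]
  · rw [RingHom.id_apply, smul_eq_mul, ← integral_const_mul]
    apply integral_congr_ae
    filter_upwards [Lp.coeFn_smul a u] with t ht
    rw [ht, Pi.smul_apply, smul_eq_mul, mul_assoc]
  · calc ‖∫ t in Icc c d, u t * ψ t‖ ≤ ∫ t in Icc c d, |C| * ‖u t‖ := by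
          apply norm_integral_le_of_norm_le (u.integrable.norm.const_mul _)
          filter_upwards [hC] with t ht
          rw [norm_mul, mul_comm]
          gcongr
          exact ht.trans (le_abs_self C)
      _ = |C| * ∫ t in Icc c d, ‖u t‖ := integral_const_mul _ _
      _ ≤ |C| * M * ‖u‖ := by
          rw [mul_assoc]
          gcongr
          exact hM u

theorem IntervalLp.continuous_integral_mul {ψ : ℝ → ℝ} (hψ : Continuous ψ) :
    Continuous fun u : IntervalLp p c d => ∫ t in Icc c d, u t * ψ t := by
  obtain ⟨C, hC⟩ := isCompact_Icc.exists_bound_of_continuousOn (hψ.continuousOn (s := Icc c d))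
  obtain ⟨Λ, hΛ⟩ := IntervalLp.exists_pairing (p := p) (c := c) (d := d) (C := C)
    hψ.aestronglyMeasurable ((ae_restrict_iff' measurableSet_Icc).2 (Filter.Eventually.of_forall hC))
  simpa only [← hΛ] using Λ.continuous

theorem IntervalLp.integrable_mul_of_continuous (u : IntervalLp p c d) {ψ : ℝ → ℝ}
    (hψ : Continuous ψ) : Integrable (fun t => u t * ψ t) (intervalMeasure c d) := by
  obtain ⟨C, hC⟩ := isCompact_Icc.exists_bound_of_continuousOn (hψ.continuousOn (s := Icc c d))
  exact u.integrable_mul_of_bdd hψ.aestronglyMeasurable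
    ((ae_restrict_iff' measurableSet_Icc).2 (Filter.Eventually.of_forall hC))

end Pairing

/-! ### Completeness, and the subspace with vanishing boundary values -/

section Closed

variable {k : ℕ} {p : ℝ≥0∞} [Fact (1 ≤ p)] {c d : ℝ}

theorem isClosed_weakDeriv_eq (j : Fin (k + 1)) {φ : ℝ → ℝ} (hφ : ContDiff ℝ (⊤ : ℕ∞) φ) :
    IsClosed {u : PiLp p (fun _ : Fin (k + 1) => IntervalLp p c d) |
      ∫ t in Icc c d, u 0 t * iteratedDeriv j φ t = (-1) ^ (j : ℕ) * ∫ t in Icc c d, u j t * φ t} :=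
  isClosed_eq
    ((IntervalLp.continuous_integral_mul (continuous_iteratedDeriv_of_smooth hφ j)).comp
      (PiLp.continuous_apply p _ 0))
    (continuous_const.mul ((IntervalLp.continuous_integral_mul hφ.continuous).comp
      (PiLp.continuous_apply p _ j)))

theorem isClosed_sobolevSubmodule :
    IsClosed (sobolevSubmodule k p c d : Set (PiLp p (fun _ : Fin (k + 1) => IntervalLp p c d))) := by
  have : (sobolevSubmodule k p c d : Set (PiLp p (fun _ : Fin (k + 1) => IntervalLp p c d))) =
      ⋂ (j : Fin (k + 1)) (φ : ℝ → ℝ) (_ : ContDiff ℝ (⊤ : ℕ∞) φ) (_ : HasCompactSupport φ)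
        (_ : tsupport φ ⊆ Ioo c d), {u : PiLp p (fun _ : Fin (k + 1) => IntervalLp p c d) |
      ∫ t in Icc c d, u 0 t * iteratedDeriv j φ t =
        (-1) ^ (j : ℕ) * ∫ t in Icc c d, u j t * φ t} := by
    ext u
    simp only [mem_iInter]
    rfl
  rw [this]
  exact isClosed_iInter fun j => isClosed_iInter fun φ => isClosed_iInter fun h =>
    isClosed_iInter fun _ => isClosed_iInter fun _ => isClosed_weakDeriv_eq j h

instance : CompleteSpace (SobolevSpace k p c d) :=
  isClosed_sobolevSubmodule.completeSpace_coe

/-- The tuples `(u_0, …, u_k)` in `L^p([c, d])` whose extensions by zero to `ℝ` satisfy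
`D^j u_0 = u_j` for every `j ≤ k`; these are the Sobolev functions with vanishing boundary values
up to order `k - 1`. -/
noncomputable def sobolevZeroSubmodule (k : ℕ) (p : ℝ≥0∞) [Fact (1 ≤ p)] (c d : ℝ) :
    Submodule ℝ (PiLp p (fun _ : Fin (k + 1) => IntervalLp p c d)) where
  -- No support condition on `φ`: the boundary values are encoded without traces, by conditions that
  -- are closed in `L^p` and stable under affine changes of variable.
  carrier := {u | ∀ (j : Fin (k + 1)) (φ : ℝ → ℝ), ContDiff ℝ (⊤ : ℕ∞) φ →
    ∫ t in Icc c d, u 0 t * iteratedDeriv j φ t = (-1) ^ (j : ℕ) * ∫ t in Icc c d, u j t * φ t}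
  zero_mem' := by
    intro j φ _
    have key : ∀ (i : Fin (k + 1)) (ψ : ℝ → ℝ),
        ∫ t in Icc c d, ((0 : PiLp p (fun _ : Fin (k + 1) => IntervalLp p c d)) i) t * ψ t = 0 := by
      intro i ψ
      apply integral_eq_zero_of_ae
      filter_upwards [Lp.coeFn_zero ℝ p (intervalMeasure c d)] with t ht
      rw [PiLp.zero_apply, ht, Pi.zero_apply, zero_mul]
    rw [key, key, mul_zero]
  add_mem' := by
    intro u v hu hv j φ h1
    have key : ∀ (i : Fin (k + 1)) (ψ : ℝ → ℝ), Continuous ψ →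
        ∫ t in Icc c d, ((u + v) i) t * ψ t
          = (∫ t in Icc c d, (u i) t * ψ t) + ∫ t in Icc c d, (v i) t * ψ t := by
      intro i ψ hψ
      rw [← integral_add (IntervalLp.integrable_mul_of_continuous _ hψ)
        (IntervalLp.integrable_mul_of_continuous _ hψ)]
      apply integral_congr_ae
      filter_upwards [Lp.coeFn_add (u i) (v i)] with t ht
      rw [PiLp.add_apply, ht, Pi.add_apply, add_mul]
    rw [key 0 _ (continuous_iteratedDeriv_of_smooth h1 j), key j _ h1.continuous, hu j φ h1,
      hv j φ h1]
    ring
  smul_mem' := by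
    intro a u hu j φ h1
    have key : ∀ (i : Fin (k + 1)) (ψ : ℝ → ℝ),
        ∫ t in Icc c d, ((a • u) i) t * ψ t = a * ∫ t in Icc c d, (u i) t * ψ t := by
      intro i ψ
      rw [← integral_const_mul]
      apply integral_congr_ae
      filter_upwards [Lp.coeFn_smul a (u i)] with t ht
      rw [PiLp.smul_apply, ht, Pi.smul_apply, smul_eq_mul, mul_assoc]
    rw [key, key, hu j φ h1]
    ring

theorem isClosed_sobolevZeroSubmodule : IsClosed
    (sobolevZeroSubmodule k p c d : Set (PiLp p (fun _ : Fin (k + 1) => IntervalLp p c d))) := by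
  have : (sobolevZeroSubmodule k p c d : Set (PiLp p (fun _ : Fin (k + 1) => IntervalLp p c d))) =
      ⋂ (j : Fin (k + 1)) (φ : ℝ → ℝ) (_ : ContDiff ℝ (⊤ : ℕ∞) φ),
        {u : PiLp p (fun _ : Fin (k + 1) => IntervalLp p c d) |
      ∫ t in Icc c d, u 0 t * iteratedDeriv j φ t =
        (-1) ^ (j : ℕ) * ∫ t in Icc c d, u j t * φ t} := by
    ext u
    simp only [mem_iInter]
    rfl
  rw [this]
  exact isClosed_iInter fun j => isClosed_iInter fun φ => isClosed_iInter fun h =>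
    isClosed_weakDeriv_eq j h

theorem sobolevZeroSubmodule_le : sobolevZeroSubmodule k p c d ≤ sobolevSubmodule k p c d :=
  fun _ hu j φ h _ _ => hu j φ h

end Closed

/-! ### Weak derivatives and primitives on an interval -/

section WeakDeriv

variable {c d : ℝ}

theorem contDiff_iteratedDeriv_of_smooth {φ : ℝ → ℝ} (hφ : ContDiff ℝ (⊤ : ℕ∞) φ) (j : ℕ) :
    ContDiff ℝ (⊤ : ℕ∞) (iteratedDeriv j φ) := by
  induction j with
  | zero => simpa using hφ
  | succ j ih => rw [iteratedDeriv_succ]; exact (contDiff_infty_iff_deriv.1 ih).2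

theorem tsupport_iteratedDeriv_subset (φ : ℝ → ℝ) (j : ℕ) :
    tsupport (iteratedDeriv j φ) ⊆ tsupport φ := by
  induction j with
  | zero => simp
  | succ j ih =>
    rw [iteratedDeriv_succ]
    exact (closure_minimal support_deriv_subset (isClosed_tsupport _)).trans ih

theorem exists_Icc_of_isCompact_subset_Ioo {K : Set ℝ} (hK : IsCompact K) (hcd : c < d)
    (hKs : K ⊆ Ioo c d) : ∃ a b, c < a ∧ b < d ∧ K ⊆ Icc a b := by
  -- The midpoint is inserted so that the compact set is nonempty and contains its infimum and
  -- supremum.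
  have hm : (c + d) / 2 ∈ Ioo c d := ⟨by linarith, by linarith⟩
  have hK' : IsCompact (insert ((c + d) / 2) K) := hK.insert _
  have hne : (insert ((c + d) / 2) K).Nonempty := insert_nonempty _ _
  have hs : insert ((c + d) / 2) K ⊆ Ioo c d := insert_subset hm hKs
  refine ⟨_, _, (hs (hK'.sInf_mem hne)).1, (hs (hK'.sSup_mem hne)).2, fun x hx => ⟨?_, ?_⟩⟩
  · exact csInf_le hK'.bddBelow (mem_insert_of_mem _ hx)
  · exact le_csSup hK'.bddAbove (mem_insert_of_mem _ hx)

/-- A test function on `(c, d)` of mean zero is the derivative of a test function on `(c, d)`. -/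
theorem exists_test_antideriv (hcd : c < d) {χ : ℝ → ℝ} (h1 : ContDiff ℝ (⊤ : ℕ∞) χ)
    (h2 : HasCompactSupport χ) (h3 : tsupport χ ⊆ Ioo c d) (h0 : ∫ t in Icc c d, χ t = 0) :
    ∃ φ : ℝ → ℝ, ContDiff ℝ (⊤ : ℕ∞) φ ∧ HasCompactSupport φ ∧ tsupport φ ⊆ Ioo c d ∧
      deriv φ = χ := by
  obtain ⟨a, b, hca, hbd, hab⟩ := exists_Icc_of_isCompact_subset_Ioo h2 hcd h3
  have hder : ∀ t, HasDerivAt (fun t => ∫ s in c..t, χ s) (χ t) t := fun t =>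
    intervalIntegral.integral_hasDerivAt_right (h1.continuous.intervalIntegrable _ _)
      h1.continuous.aestronglyMeasurable.stronglyMeasurableAtFilter h1.continuous.continuousAt
  have hderiv : deriv (fun t => ∫ s in c..t, χ s) = χ := funext fun t => (hder t).deriv
  have hzero : ∀ t, t ∉ Icc a b → χ t = 0 := fun t ht =>
    image_eq_zero_of_notMem_tsupport fun h => ht (hab h)
  have hsupp : tsupport (fun t => ∫ s in c..t, χ s) ⊆ Icc a b := by
    refine closure_minimal (fun t ht => ?_) isClosed_Icc
    by_contra hcon
    apply ht
    rcases lt_or_ge t a with hta | hta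
    · refine intervalIntegral.integral_zero_ae (Filter.Eventually.of_forall fun s hs => ?_)
      refine hzero s fun hs' => ?_
      have := hs.2
      rcases le_max_iff.1 this with h | h <;> linarith [hs'.1]
    -- Beyond `b`, split at `d`: the integral up to `d` is the mean of `χ`, which is zero, and `χ`
    -- vanishes between `d` and `t`.
    · have htb : b < t := not_le.1 fun h => hcon ⟨hta, h⟩
      have hI : ∫ s in c..d, χ s = 0 := by
        rw [intervalIntegral.integral_of_le hcd.le, ← integral_Icc_eq_integral_Ioc, h0]
      have hII : ∫ s in d..t, χ s = 0 := by
        refine intervalIntegral.integral_zero_ae (Filter.Eventually.of_forall fun s hs => ?_)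
        refine hzero s fun hs' => ?_
        have := hs.1
        rcases min_lt_iff.1 this with h | h <;> linarith [hs'.2]
      have := intervalIntegral.integral_add_adjacent_intervals
        (h1.continuous.intervalIntegrable (μ := volume) c d)
        (h1.continuous.intervalIntegrable (μ := volume) d t)
      simp only
      rw [← this, hI, hII, add_zero]
  refine ⟨fun t => ∫ s in c..t, χ s, ?_, ?_, ?_, hderiv⟩
  · rw [contDiff_infty_iff_deriv, hderiv]
    exact ⟨fun t => (hder t).differentiableAt, h1⟩
  · exact isCompact_Icc.of_isClosed_subset (isClosed_tsupport _) hsupp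
  · exact hsupp.trans fun t ht => ⟨hca.trans_le ht.1, ht.2.trans_lt hbd⟩

theorem exists_test_integral_eq_one (hcd : c < d) :
    ∃ ρ : ℝ → ℝ, ContDiff ℝ (⊤ : ℕ∞) ρ ∧ HasCompactSupport ρ ∧ tsupport ρ ⊆ Ioo c d ∧
      ∫ t in Icc c d, ρ t = 1 := by
  let B : ContDiffBump ((c + d) / 2) :=
    { rIn := (d - c) / 8
      rOut := (d - c) / 4
      rIn_pos := by linarith
      rIn_lt_rOut := by linarith }
  have hsub : tsupport (B.normed volume) ⊆ Ioo c d := by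
    rw [B.tsupport_normed_eq, Real.closedBall_eq_Icc]
    intro t ht
    change t ∈ Icc ((c + d) / 2 - (d - c) / 4) ((c + d) / 2 + (d - c) / 4) at ht
    exact ⟨by linarith [ht.1], by linarith [ht.2]⟩
  refine ⟨B.normed volume, B.contDiff_normed, B.hasCompactSupport_normed, hsub, ?_⟩
  rw [setIntegral_eq_integral_of_forall_compl_eq_zero, B.integral_normed]
  exact fun t ht => image_eq_zero_of_notMem_tsupport fun h => ht (Ioo_subset_Icc_self (hsub h))

theorem integrable_mul_of_continuous {u ψ : ℝ → ℝ} (hu : IntegrableOn u (Icc c d))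
    (hψ : Continuous ψ) : Integrable (fun t => u t * ψ t) (intervalMeasure c d) := by
  obtain ⟨C, hC⟩ := isCompact_Icc.exists_bound_of_continuousOn (hψ.continuousOn (s := Icc c d))
  exact hu.mul_bdd hψ.aestronglyMeasurable
    ((ae_restrict_iff' measurableSet_Icc).2 (Filter.Eventually.of_forall hC))

theorem ae_eq_of_forall_test {u v : ℝ → ℝ} (hu : IntegrableOn u (Icc c d))
    (hv : IntegrableOn v (Icc c d))
    (h : ∀ φ : ℝ → ℝ, ContDiff ℝ (⊤ : ℕ∞) φ → HasCompactSupport φ → tsupport φ ⊆ Ioo c d →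
      ∫ t in Icc c d, u t * φ t = ∫ t in Icc c d, v t * φ t) :
    u =ᵐ[intervalMeasure c d] v := by
  have hz : ∀ᵐ t ∂(volume : Measure ℝ), t ∈ Ioo c d → (u - v) t = 0 := by
    refine isOpen_Ioo.ae_eq_zero_of_integral_contDiff_smul_eq_zero
      ((hu.sub hv).mono_set Ioo_subset_Icc_self).locallyIntegrableOn fun φ h1 h2 h3 => ?_
    rw [← setIntegral_eq_integral_of_forall_compl_eq_zero (s := Icc c d) fun t ht => by
      rw [image_eq_zero_of_notMem_tsupport fun hh => ht (Ioo_subset_Icc_self (h3 hh)), zero_smul]]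
    rw [← sub_eq_zero.2 (h φ h1 h2 h3),
      ← integral_sub (integrable_mul_of_continuous hu h1.continuous)
        (integrable_mul_of_continuous hv h1.continuous)]
    congr 1
    funext t
    simp only [Pi.sub_apply, smul_eq_mul]
    ring
  have hz' : ∀ᵐ t ∂(volume.restrict (Ioo c d)), (u - v) t = 0 :=
    (ae_restrict_iff' measurableSet_Ioo).2 hz
  rw [Measure.restrict_congr_set Ioo_ae_eq_Icc] at hz'
  filter_upwards [hz'] with t ht
  exact sub_eq_zero.1 ht

/-- The du Bois-Reymond lemma. -/
theorem ae_eq_const_of_isWeakDeriv_zero (hcd : c < d) {u : ℝ → ℝ} (hu : IntegrableOn u (Icc c d))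
    (h : IsWeakDeriv c d 1 u 0) : ∃ C : ℝ, u =ᵐ[intervalMeasure c d] fun _ => C := by
  obtain ⟨ρ, r1, r2, r3, r4⟩ := exists_test_integral_eq_one hcd
  refine ⟨∫ t in Icc c d, u t * ρ t, ae_eq_of_forall_test hu (integrable_const _)
    fun ψ p1 p2 p3 => ?_⟩
  -- `ψ - (∫ ψ) ρ` has mean zero, so it is the derivative of a test function and `u` annihilates it.
  -- This says `∫ u ψ = (∫ u ρ) (∫ ψ)`.
  have hs : tsupport (fun t => (∫ s in Icc c d, ψ s) * ρ t) ⊆ tsupport ρ :=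
    tsupport_mul_subset_right (f := fun _ => ∫ s in Icc c d, ψ s)
  have c1 : ContDiff ℝ (⊤ : ℕ∞) fun t => ψ t - (∫ s in Icc c d, ψ s) * ρ t :=
    p1.sub (contDiff_const.mul r1)
  have c3 : tsupport (fun t => ψ t - (∫ s in Icc c d, ψ s) * ρ t) ⊆ tsupport ψ ∪ tsupport ρ :=
    (tsupport_sub ψ fun t => (∫ s in Icc c d, ψ s) * ρ t).trans (union_subset_union_right _ hs)
  have c2 : HasCompactSupport fun t => ψ t - (∫ s in Icc c d, ψ s) * ρ t :=
    (p2.isCompact.union r2.isCompact).of_isClosed_subset (isClosed_tsupport _) c3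
  have hψi : Integrable ψ (intervalMeasure c d) := p1.continuous.integrableOn_Icc
  have hρi : Integrable ρ (intervalMeasure c d) := r1.continuous.integrableOn_Icc
  obtain ⟨φ, f1, f2, f3, f4⟩ := exists_test_antideriv hcd c1 c2 (c3.trans (union_subset p3 r3)) (by
    rw [integral_sub hψi (hρi.const_mul _), integral_const_mul, r4, mul_one, sub_self])
  have := h φ f1 f2 f3
  simp only [iteratedDeriv_one, f4, Pi.zero_apply, zero_mul, integral_zero, mul_zero, mul_sub]
    at this
  rw [integral_sub (integrable_mul_of_continuous hu p1.continuous)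
    (by simpa only [mul_left_comm] using
      (integrable_mul_of_continuous hu r1.continuous).const_mul (∫ s in Icc c d, ψ s))] at this
  simp only [mul_left_comm _ (∫ s in Icc c d, ψ s), integral_const_mul] at this
  rw [integral_const_mul, sub_eq_zero.1 this, mul_comm]

/-- Integration by parts for absolutely continuous functions. The primitive vanishes at `c`; the
term at `d` stays because `φ` need not vanish there. -/
theorem integral_primitive_mul_deriv (hcd : c ≤ d) {v φ : ℝ → ℝ} (hv : IntegrableOn v (Icc c d))
    (hφ : ContDiff ℝ (⊤ : ℕ∞) φ) :
    ∫ t in Icc c d, (∫ s in c..t, v s) * deriv φ t =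
      (∫ s in c..d, v s) * φ d - ∫ t in Icc c d, v t * φ t := by
  have hvi : IntervalIntegrable v volume c d := by
    rwa [intervalIntegrable_iff_integrableOn_Icc_of_le hcd]
  have hac := hvi.absolutelyContinuousOnInterval_intervalIntegral (c := c) (by simp)
  have hφac : AbsolutelyContinuousOnInterval φ c d :=
    (hφ.of_le (by exact_mod_cast le_top)).contDiffOn.absolutelyContinuousOnInterval
  have h := hac.integral_mul_deriv_eq_deriv_mul hφac
  rw [intervalIntegral.integral_same, zero_mul, sub_zero] at h
  rw [integral_Icc_eq_integral_Ioc, ← intervalIntegral.integral_of_le hcd, h,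
    integral_Icc_eq_integral_Ioc, ← intervalIntegral.integral_of_le hcd]
  congr 1
  apply intervalIntegral.integral_congr_ae
  filter_upwards [hvi.ae_hasDerivAt_integral] with t ht hts
  rw [(ht (uIoc_subset_uIcc hts) c (by simp)).deriv]

theorem continuousOn_primitive_of_integrableOn (hcd : c ≤ d) {v : ℝ → ℝ}
    (hv : IntegrableOn v (Icc c d)) :
    ContinuousOn (fun t => ∫ s in c..t, v s) (Icc c d) := by
  have hvi : IntervalIntegrable v volume c d := by
    rwa [intervalIntegrable_iff_integrableOn_Icc_of_le hcd]
  simpa [uIcc_of_le hcd] using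
    (hvi.absolutelyContinuousOnInterval_intervalIntegral (c := c) (by simp)).continuousOn

theorem isWeakDeriv_primitive (hcd : c ≤ d) {v : ℝ → ℝ} (hv : IntegrableOn v (Icc c d)) :
    IsWeakDeriv c d 1 (fun t => ∫ s in c..t, v s) v := by
  intro φ h1 _ h3
  have hd : φ d = 0 := image_eq_zero_of_notMem_tsupport fun h => lt_irrefl d (h3 h).2
  rw [iteratedDeriv_one, integral_primitive_mul_deriv hcd hv h1, hd]
  ring

/-- A function with an integrable weak derivative is a primitive of it, up to a constant. -/
theorem IsWeakDeriv.ae_eq_primitive (hcd : c < d) {u v : ℝ → ℝ} (hu : IntegrableOn u (Icc c d))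
    (hv : IntegrableOn v (Icc c d)) (h : IsWeakDeriv c d 1 u v) :
    ∃ C : ℝ, u =ᵐ[intervalMeasure c d] fun t => C + ∫ s in c..t, v s := by
  have hU : IntegrableOn (fun t => ∫ s in c..t, v s) (Icc c d) :=
    (continuousOn_primitive_of_integrableOn hcd.le hv).integrableOn_Icc
  obtain ⟨C, hC⟩ := ae_eq_const_of_isWeakDeriv_zero hcd (hu.sub hU) fun φ h1 h2 h3 => by
    have e1 := h φ h1 h2 h3
    have e2 := isWeakDeriv_primitive hcd.le hv φ h1 h2 h3
    simp only [Pi.sub_apply, sub_mul, Pi.zero_apply, zero_mul, integral_zero, mul_zero]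
    rw [integral_sub (integrable_mul_of_continuous hu (continuous_iteratedDeriv_of_smooth h1 1))
      (integrable_mul_of_continuous hU (continuous_iteratedDeriv_of_smooth h1 1)), e1, e2, sub_self]
  refine ⟨C, ?_⟩
  filter_upwards [hC] with t ht
  simp only [Pi.sub_apply] at ht
  linarith

theorem eqOn_Icc_of_ae_eq (hcd : c < d) {f g : ℝ → ℝ} (hf : ContinuousOn f (Icc c d))
    (hg : ContinuousOn g (Icc c d)) (h : f =ᵐ[intervalMeasure c d] g) : EqOn f g (Icc c d) :=
  Measure.eqOn_Icc_of_ae_eq volume hcd.ne h hf hg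

/-- Integration by parts against a weak derivative, without boundary terms, for a function that
vanishes at the endpoints. -/
theorem IsWeakDeriv.integral_mul_deriv_of_endpoints (hcd : c < d) {u v h : ℝ → ℝ}
    (hu : IntegrableOn u (Icc c d)) (hv : IntegrableOn v (Icc c d)) (huv : IsWeakDeriv c d 1 u v)
    (hh : ContinuousOn h (Icc c d)) (huh : u =ᵐ[intervalMeasure c d] h) (hc : h c = 0)
    (hd : h d = 0) {φ : ℝ → ℝ} (hφ : ContDiff ℝ (⊤ : ℕ∞) φ) :
    ∫ t in Icc c d, u t * deriv φ t = -∫ t in Icc c d, v t * φ t := by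
  -- Almost everywhere `u` is a constant plus the primitive of `v`. The value at `c` kills the
  -- constant, and the value at `d` then kills the total integral of `v`, that is, the boundary
  -- term.
  obtain ⟨C, hC⟩ := huv.ae_eq_primitive hcd hu hv
  have heq := eqOn_Icc_of_ae_eq hcd hh
    (continuousOn_const.add (continuousOn_primitive_of_integrableOn hcd.le hv)) (huh.symm.trans hC)
  have hC0 : C = 0 := by simpa [hc] using (heq (left_mem_Icc.2 hcd.le)).symm
  have hId : ∫ s in c..d, v s = 0 := by simpa [hd, hC0] using (heq (right_mem_Icc.2 hcd.le)).symm
  have := integral_primitive_mul_deriv hcd.le hv hφ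
  rw [hId, zero_mul, zero_sub] at this
  rw [← this]
  apply integral_congr_ae
  filter_upwards [hC] with t ht
  rw [ht, hC0, zero_add]

end WeakDeriv

/-! ### Equal boundary values -/

namespace SobolevSpace

variable {k : ℕ} {p : ℝ≥0∞} [Fact (1 ≤ p)] {c d : ℝ}

/-- The definition compares every component with the zeroth one only; testing with `φ⁽ʲ⁾` relates
any two of them. -/
theorem isWeakDeriv_wderiv (u : SobolevSpace k p c d) (i j : ℕ) (hi : i + j < k + 1) :
    IsWeakDeriv c d j (u.wderiv ⟨i, by omega⟩) (u.wderiv ⟨i + j, hi⟩) := by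
  intro φ h1 h2 h3
  have e1 := u.2 ⟨i, by omega⟩ (iteratedDeriv j φ)
    (contDiff_iteratedDeriv_of_smooth h1 j)
    (hasCompactSupport_iteratedDeriv h2 j) ((tsupport_iteratedDeriv_subset φ j).trans h3)
  have e2 := u.2 ⟨i + j, hi⟩ φ h1 h2 h3
  have e3 : iteratedDeriv i (iteratedDeriv j φ) = iteratedDeriv (i + j) φ := by
    simp only [iteratedDeriv_eq_iterate, Function.iterate_add_apply]
  simp only [e3] at e1
  rw [e2, pow_add, mul_assoc] at e1
  exact (mul_left_cancel₀ (pow_ne_zero _ (by norm_num)) e1).symm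

/-- Functions with the same boundary values differ by an element of `sobolevZeroSubmodule`. -/
theorem EqAtEndpoints.sub_mem (hcd : c < d) {u v : SobolevSpace k p c d} (h : EqAtEndpoints u v) :
    ((u - v : SobolevSpace k p c d) : PiLp p (fun _ : Fin (k + 1) => IntervalLp p c d)) ∈
      sobolevZeroSubmodule k p c d := by
  set w := u - v with hw
  have hint : ∀ g : IntervalLp p c d, IntegrableOn g (Icc c d) := fun g => g.integrable
  -- Induction moves one derivative at a time: the hypothesis is applied to `φ'`, then one
  -- integrates by parts using that the representative of `D^j w` vanishes at both endpoints.
  have key : ∀ j : ℕ, ∀ hj : j < k + 1, ∀ φ : ℝ → ℝ, ContDiff ℝ (⊤ : ℕ∞) φ →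
      ∫ t in Icc c d, w.1 0 t * iteratedDeriv j φ t =
        (-1) ^ j * ∫ t in Icc c d, w.1 ⟨j, hj⟩ t * φ t := by
    intro j
    induction j with
    | zero => intro hj φ _; simp
    | succ j ih =>
      intro hj φ hφ
      obtain ⟨f, g, hf, hg, huf, hvg, hc, hd⟩ := h ⟨j, by omega⟩
      have hdφ : ContDiff ℝ (⊤ : ℕ∞) (deriv φ) := (contDiff_infty_iff_deriv.1 hφ).2
      have hwd := (isWeakDeriv_wderiv w j 1 hj).integral_mul_deriv_of_endpoints hcd
        (h := f - g) (hint _) (hint _) (hf.sub hg) (by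
          filter_upwards [huf, hvg, Lp.coeFn_sub (u.wderiv ⟨j, by omega⟩)
            (v.wderiv ⟨j, by omega⟩)] with t h1 h2 h3
          rw [Pi.sub_apply, ← h1, ← h2]
          exact h3) (by simp [hc]) (by simp [hd]) hφ
      rw [iteratedDeriv_succ', ih (by omega) _ hdφ, pow_succ, mul_assoc, neg_one_mul]
      congr 1
  exact fun j φ hφ => key j j.2 φ hφ

end SobolevSpace

/-! ### Dyadic intervals and Haar functions -/

namespace Haar

/-- The length of the dyadic interval with heap index `m`. -/
noncomputable def len (c d : ℝ) (m : ℕ) : ℝ := (d - c) / 2 ^ Nat.log 2 m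

/-- The left endpoint of the dyadic interval with heap index `m`. -/
noncomputable def left (c d : ℝ) (m : ℕ) : ℝ := c + ((m : ℝ) - 2 ^ Nat.log 2 m) * len c d m

/-- The dyadic subintervals of `(c, d]` in heap order: the interval with index `1` is `(c, d]`, and
the halves of the `m`-th interval have the indices `2 m` and `2 m + 1`. -/
noncomputable def dyadic (c d : ℝ) (m : ℕ) : Set ℝ := Ioc (left c d m) (left c d m + len c d m)

/-- The Haar functions on `(c, d]`. -/
noncomputable def haar (c d : ℝ) (m : ℕ) (t : ℝ) : ℝ :=
  if m = 0 then 1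
  else (dyadic c d (2 * m)).indicator 1 t - (dyadic c d (2 * m + 1)).indicator 1 t

variable {c d : ℝ}

theorem len_pos (hcd : c < d) (m : ℕ) : 0 < len c d m :=
  div_pos (sub_pos.2 hcd) (by positivity)

/-- Since `Nat.log 2 0 = 0`, index `0` also has length `d - c`, the integral of the square of the
constant Haar function. -/
theorem len_zero : len c d 0 = d - c := by simp [len]

theorem log_two_mul {m : ℕ} (hm : m ≠ 0) : Nat.log 2 (2 * m) = Nat.log 2 m + 1 := by
  rw [mul_comm, Nat.log_mul_base one_lt_two hm]

theorem log_two_mul_add_one {m : ℕ} (hm : m ≠ 0) : Nat.log 2 (2 * m + 1) = Nat.log 2 m + 1 := by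
  rw [Nat.log_of_one_lt_of_le one_lt_two (by omega)]
  congr 2
  omega

theorem len_two_mul {m : ℕ} (hm : m ≠ 0) : len c d (2 * m) = len c d m / 2 := by
  rw [len, len, log_two_mul hm, pow_succ]
  field_simp

theorem len_two_mul_add_one {m : ℕ} (hm : m ≠ 0) : len c d (2 * m + 1) = len c d m / 2 := by
  rw [len, len, log_two_mul_add_one hm, pow_succ]
  field_simp

theorem left_two_mul {m : ℕ} (hm : m ≠ 0) : left c d (2 * m) = left c d m := by
  rw [left, left, len_two_mul hm, log_two_mul hm, pow_succ]
  push_cast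
  ring

theorem left_two_mul_add_one {m : ℕ} (hm : m ≠ 0) :
    left c d (2 * m + 1) = left c d m + len c d m / 2 := by
  rw [left, left, len_two_mul_add_one hm, log_two_mul_add_one hm, pow_succ]
  push_cast
  ring

theorem dyadic_one : dyadic c d 1 = Ioc c d := by
  simp [dyadic, left, len]

theorem mem_dyadic_iff (hcd : c < d) {m : ℕ} (hm : m ≠ 0) {t : ℝ} :
    t ∈ dyadic c d m ↔ t ∈ dyadic c d (2 * m) ∨ t ∈ dyadic c d (2 * m + 1) := by
  have := len_pos hcd m
  simp only [dyadic, mem_Ioc, len_two_mul hm, len_two_mul_add_one hm, left_two_mul hm,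
    left_two_mul_add_one hm]
  constructor
  · rintro ⟨h1, h2⟩
    rcases le_or_gt t (left c d m + len c d m / 2) with h | h
    · exact Or.inl ⟨h1, h⟩
    · exact Or.inr ⟨h, by linarith⟩
  · rintro (⟨h1, h2⟩ | ⟨h1, h2⟩)
    · exact ⟨h1, by linarith⟩
    · exact ⟨by linarith, by linarith⟩

theorem disjoint_dyadic {m : ℕ} (hm : m ≠ 0) :
    Disjoint (dyadic c d (2 * m)) (dyadic c d (2 * m + 1)) := by
  rw [Set.disjoint_left]
  simp only [dyadic, mem_Ioc, len_two_mul hm, len_two_mul_add_one hm, left_two_mul hm,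
    left_two_mul_add_one hm]
  rintro t ⟨_, h⟩ ⟨h', _⟩
  linarith

theorem dyadic_subset_half (hcd : c < d) {m : ℕ} (hm : 2 ≤ m) :
    dyadic c d m ⊆ dyadic c d (m / 2) := by
  intro t ht
  rw [mem_dyadic_iff hcd (by omega)]
  rcases Nat.even_or_odd' m with ⟨r, rfl | rfl⟩
  · left
    rwa [Nat.mul_div_cancel_left r two_pos]
  · right
    rwa [show (2 * r + 1) / 2 = r by omega]

theorem dyadic_subset (hcd : c < d) {m : ℕ} (hm : m ≠ 0) : dyadic c d m ⊆ Ioc c d := by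
  induction m using Nat.strong_induction_on with
  | _ m ih =>
    rcases Nat.lt_or_ge m 2 with h | h
    · obtain rfl : m = 1 := by omega
      rw [dyadic_one]
    · exact (dyadic_subset_half hcd h).trans (ih (m / 2) (by omega) (by omega))

/-- For every `n ≥ 1` the intervals with indices in `[n, 2n)` partition `(c, d]`: going from `n` to
`n + 1` replaces the `n`-th interval by its halves `2n` and `2n + 1`. Thus every partial sum of the
Haar series has its own partition, not only those ending at a full dyadic level. -/
theorem exists_mem_dyadic (hcd : c < d) {n : ℕ} (hn : 1 ≤ n) {t : ℝ} (ht : t ∈ Ioc c d) :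
    ∃ m ∈ Finset.Ico n (2 * n), t ∈ dyadic c d m := by
  induction n, hn using Nat.le_induction with
  | base => exact ⟨1, by simp, by rwa [dyadic_one]⟩
  | succ n hn ih =>
    obtain ⟨m, hm, htm⟩ := ih
    rw [Finset.mem_Ico] at hm
    rcases hm.1.eq_or_lt with rfl | hlt
    · rcases (mem_dyadic_iff hcd (by omega)).1 htm with h | h
      · exact ⟨_, by rw [Finset.mem_Ico]; omega, h⟩
      · exact ⟨_, by rw [Finset.mem_Ico]; omega, h⟩
    · exact ⟨m, by rw [Finset.mem_Ico]; omega, htm⟩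

theorem eq_of_mem_dyadic (hcd : c < d) {n : ℕ} (hn : 1 ≤ n) {t : ℝ} {m m' : ℕ}
    (hm : m ∈ Finset.Ico n (2 * n)) (hm' : m' ∈ Finset.Ico n (2 * n)) (ht : t ∈ dyadic c d m)
    (ht' : t ∈ dyadic c d m') : m = m' := by
  induction n, hn using Nat.le_induction generalizing m m' with
  | base => simp only [Finset.mem_Ico] at hm hm'; omega
  | succ n hn ih =>
    simp only [Finset.mem_Ico] at hm hm' ih
    have key : ∀ {r : ℕ}, n + 1 ≤ r ∧ r < 2 * (n + 1) → t ∈ dyadic c d r →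
        (r < 2 * n ∧ n < r) ∨ (t ∈ dyadic c d n ∧ (r = 2 * n ∨ r = 2 * n + 1)) := by
      intro r hr h
      rcases Nat.lt_or_ge r (2 * n) with h1 | h1
      · exact Or.inl ⟨h1, by omega⟩
      · refine Or.inr ⟨?_, by omega⟩
        have := dyadic_subset_half hcd (by omega) h
        rwa [show r / 2 = n by omega] at this
    rcases key hm ht with h | ⟨h1, h2⟩ <;> rcases key hm' ht' with h' | ⟨h1', h2'⟩
    · exact ih (by omega) (by omega) ht ht'
    · exact absurd (ih (m := m) (m' := n) (by omega) (by omega) ht h1') (by omega)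
    · exact absurd (ih (m := n) (m' := m') (by omega) (by omega) h1 ht') (by omega)
    · have hdis := Set.disjoint_left.1 (disjoint_dyadic (c := c) (d := d) (m := n) (by omega))
      rcases h2 with rfl | rfl <;> rcases h2' with rfl | rfl
      · rfl
      · exact absurd ht' (hdis ht)
      · exact absurd ht (hdis ht')
      · rfl

theorem measurableSet_dyadic (m : ℕ) : MeasurableSet (dyadic c d m) := measurableSet_Ioc

theorem volume_dyadic (m : ℕ) : volume (dyadic c d m) = ENNReal.ofReal (len c d m) := by
  rw [dyadic, Real.volume_Ioc, add_sub_cancel_left]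

theorem haar_zero (t : ℝ) : haar c d 0 t = 1 := if_pos rfl

theorem haar_of_ne {m : ℕ} (hm : m ≠ 0) (t : ℝ) : haar c d m t =
    (dyadic c d (2 * m)).indicator 1 t - (dyadic c d (2 * m + 1)).indicator 1 t := if_neg hm

theorem haar_eq_one {m : ℕ} (hm : m ≠ 0) {t : ℝ} (ht : t ∈ dyadic c d (2 * m)) :
    haar c d m t = 1 := by
  rw [haar_of_ne hm, indicator_of_mem ht,
    indicator_of_notMem (Set.disjoint_left.1 (disjoint_dyadic hm) ht)]
  simp

theorem haar_eq_neg_one {m : ℕ} (hm : m ≠ 0) {t : ℝ} (ht : t ∈ dyadic c d (2 * m + 1)) :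
    haar c d m t = -1 := by
  rw [haar_of_ne hm, indicator_of_mem ht,
    indicator_of_notMem (Set.disjoint_right.1 (disjoint_dyadic hm) ht)]
  simp

theorem haar_eq_zero (hcd : c < d) {m : ℕ} (hm : m ≠ 0) {t : ℝ} (ht : t ∉ dyadic c d m) :
    haar c d m t = 0 := by
  rw [mem_dyadic_iff hcd hm, not_or] at ht
  rw [haar_of_ne hm, indicator_of_notMem ht.1, indicator_of_notMem ht.2, sub_zero]

theorem measurable_haar (m : ℕ) : Measurable (haar c d m) := by
  by_cases hm : m = 0
  · subst hm
    rw [show haar c d 0 = fun _ => 1 from funext haar_zero]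
    exact measurable_const
  · rw [show haar c d m = (dyadic c d (2 * m)).indicator 1 - (dyadic c d (2 * m + 1)).indicator 1
      from funext fun t => haar_of_ne hm t]
    exact (measurable_one.indicator (measurableSet_dyadic _)).sub
      (measurable_one.indicator (measurableSet_dyadic _))

theorem norm_haar_le (hcd : c < d) (m : ℕ) (t : ℝ) : ‖haar c d m t‖ ≤ 1 := by
  by_cases hm : m = 0
  · subst hm
    simp [haar_zero]
  · by_cases ht : t ∈ dyadic c d m
    · rcases (mem_dyadic_iff hcd hm).1 ht with h | h
      · simp [haar_eq_one hm h]
      · simp [haar_eq_neg_one hm h]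
    · simp [haar_eq_zero hcd hm ht]

/-- A Haar function is constant on every dyadic interval with a larger heap index. -/
theorem exists_haar_eq_const (hcd : c < d) {i m : ℕ} (him : i < m) :
    ∃ κ : ℝ, ∀ t ∈ dyadic c d m, haar c d i t = κ := by
  rcases Nat.eq_zero_or_pos i with rfl | hi
  · exact ⟨1, fun t _ => haar_zero t⟩
  induction m using Nat.strong_induction_on with
  | _ m ih =>
    -- Compare `i` with the parent of `m`: below it the constant is inherited, at equality `m` is a
    -- half of `i`, and above it both indices lie in `[i, 2i)`, so the intervals are disjoint.
    rcases Nat.lt_trichotomy i (m / 2) with h | h | h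
    · obtain ⟨κ, hκ⟩ := ih (m / 2) (by omega) h
      exact ⟨κ, fun t ht => hκ t (dyadic_subset_half hcd (by omega) ht)⟩
    · rcases Nat.even_or_odd' m with ⟨r, rfl | rfl⟩
      · obtain rfl : i = r := by omega
        exact ⟨1, fun t ht => haar_eq_one (by omega) ht⟩
      · obtain rfl : i = r := by omega
        exact ⟨-1, fun t ht => haar_eq_neg_one (by omega) ht⟩
    · refine ⟨0, fun t ht => haar_eq_zero hcd (by omega) fun ht' => ?_⟩
      have := eq_of_mem_dyadic hcd hi (Finset.mem_Ico.2 ⟨le_rfl, by omega⟩)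
        (Finset.mem_Ico.2 ⟨him.le, by omega⟩) ht' ht
      omega

theorem setIntegral_mul_indicator_dyadic (hcd : c < d) {m : ℕ} (hm : m ≠ 0) (f : ℝ → ℝ) :
    ∫ t in Icc c d, f t * (dyadic c d m).indicator 1 t = ∫ t in dyadic c d m, f t := by
  have : ∀ t, f t * (dyadic c d m).indicator 1 t = (dyadic c d m).indicator f t := fun t => by
    by_cases ht : t ∈ dyadic c d m <;> simp [ht]
  simp only [this]
  rw [setIntegral_indicator (measurableSet_dyadic m),
    inter_eq_self_of_subset_right ((dyadic_subset hcd hm).trans Ioc_subset_Icc_self)]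

theorem integrable_mul_indicator_dyadic {f : ℝ → ℝ} (hf : IntegrableOn f (Icc c d)) (m : ℕ) :
    IntegrableOn (fun t => f t * (dyadic c d m).indicator 1 t) (Icc c d) := by
  have : (fun t => f t * (dyadic c d m).indicator 1 t) = (dyadic c d m).indicator f := by
    funext t
    by_cases ht : t ∈ dyadic c d m <;> simp [ht]
  rw [this]
  exact Integrable.indicator hf (measurableSet_dyadic m)

theorem setIntegral_mul_haar (hcd : c < d) {m : ℕ} (hm : m ≠ 0) {f : ℝ → ℝ}
    (hf : IntegrableOn f (Icc c d)) : ∫ t in Icc c d, f t * haar c d m t =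
      (∫ t in dyadic c d (2 * m), f t) - ∫ t in dyadic c d (2 * m + 1), f t := by
  simp only [haar_of_ne hm, mul_sub]
  rw [integral_sub (integrable_mul_indicator_dyadic hf _) (integrable_mul_indicator_dyadic hf _),
    setIntegral_mul_indicator_dyadic hcd (by omega),
    setIntegral_mul_indicator_dyadic hcd (by omega)]

theorem setIntegral_dyadic (hcd : c < d) {m : ℕ} (hm : m ≠ 0) {f : ℝ → ℝ}
    (hf : IntegrableOn f (Icc c d)) : ∫ t in dyadic c d m, f t =
      (∫ t in dyadic c d (2 * m), f t) + ∫ t in dyadic c d (2 * m + 1), f t := by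
  have hsub : ∀ r, r ≠ 0 → IntegrableOn f (dyadic c d r) := fun r hr =>
    hf.mono_set ((dyadic_subset hcd hr).trans Ioc_subset_Icc_self)
  rw [← setIntegral_union (disjoint_dyadic hm) (measurableSet_dyadic _) (hsub _ (by omega))
    (hsub _ (by omega))]
  congr 2
  ext t
  exact mem_dyadic_iff hcd hm

theorem setIntegral_haar (hcd : c < d) {m : ℕ} (hm : m ≠ 0) :
    ∫ t in Icc c d, haar c d m t = 0 := by
  have h := setIntegral_mul_haar hcd hm (f := fun _ => 1) (integrableOn_const (by simp))
  simp only [one_mul, setIntegral_const, smul_eq_mul, mul_one, measureReal_def, volume_dyadic,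
    len_two_mul hm, len_two_mul_add_one hm, sub_self] at h
  exact h

/-- The earlier function is constant on the support of the later one, which has mean zero. -/
theorem setIntegral_haar_mul_haar_of_lt (hcd : c < d) {i j : ℕ} (hij : i < j) :
    ∫ t in Icc c d, haar c d i t * haar c d j t = 0 := by
  obtain ⟨κ, hκ⟩ := exists_haar_eq_const hcd hij
  have : ∀ t, haar c d i t * haar c d j t = κ * haar c d j t := fun t => by
    by_cases ht : t ∈ dyadic c d j
    · rw [hκ t ht]
    · rw [haar_eq_zero hcd (by omega) ht, mul_zero, mul_zero]
  simp only [this]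
  rw [integral_const_mul, setIntegral_haar hcd (by omega), mul_zero]

theorem setIntegral_haar_mul_self (hcd : c < d) (m : ℕ) :
    ∫ t in Icc c d, haar c d m t * haar c d m t = len c d m := by
  by_cases hm : m = 0
  · subst hm
    simp [haar_zero, len_zero, measureReal_def, hcd.le]
  · have : ∀ t, haar c d m t * haar c d m t = 1 * (dyadic c d m).indicator 1 t := fun t => by
      by_cases ht : t ∈ dyadic c d m
      · rw [indicator_of_mem ht]
        rcases (mem_dyadic_iff hcd hm).1 ht with h | h
        · simp [haar_eq_one hm h]
        · simp [haar_eq_neg_one hm h]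
      · simp [haar_eq_zero hcd hm ht, ht]
    simp only [this]
    rw [setIntegral_mul_indicator_dyadic hcd hm]
    simp [measureReal_def, volume_dyadic, (len_pos hcd m).le]

/-- The function whose value on each dyadic interval with index in `[n, 2 n)` is the average of
`f` over that interval. -/
noncomputable def average (c d : ℝ) (f : ℝ → ℝ) (n : ℕ) (t : ℝ) : ℝ :=
  ∑ m ∈ Finset.Ico n (2 * n),
    (∫ s in dyadic c d m, f s) / len c d m * (dyadic c d m).indicator 1 t

theorem average_of_mem (hcd : c < d) (f : ℝ → ℝ) {n m : ℕ} (hn : 1 ≤ n)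
    (hm : m ∈ Finset.Ico n (2 * n)) {t : ℝ} (ht : t ∈ dyadic c d m) :
    average c d f n t = (∫ s in dyadic c d m, f s) / len c d m := by
  rw [average, Finset.sum_eq_single_of_mem m hm]
  · simp [ht]
  · intro m' hm' hne
    rw [indicator_of_notMem fun ht' => hne (eq_of_mem_dyadic hcd hn hm' hm ht' ht), mul_zero]

/-- The partial sums of the Haar expansion are averages. -/
theorem sum_haar_eq_average (hcd : c < d) {f : ℝ → ℝ} (hf : IntegrableOn f (Icc c d)) {n : ℕ}
    (hn : 1 ≤ n) {t : ℝ} (ht : t ∈ Ioc c d) :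
    ∑ i ∈ Finset.range n, (∫ s in Icc c d, f s * (haar c d i s / len c d i)) * haar c d i t =
      average c d f n t := by
  have hdiv : ∀ i, ∫ s in Icc c d, f s * (haar c d i s / len c d i) =
      (∫ s in Icc c d, f s * haar c d i s) / len c d i := fun i => by
    rw [← integral_div]
    simp only [mul_div_assoc]
  simp only [hdiv]
  induction n, hn using Nat.le_induction with
  | base =>
    simp only [average, Finset.range_one, Finset.sum_singleton, haar_zero, mul_one,
      Nat.Ico_succ_singleton, dyadic_one, ht, indicator_of_mem, Pi.one_apply, len_zero]
    rw [integral_Icc_eq_integral_Ioc]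
    simp [len]
  | succ n hn ih =>
    have hn0 : n ≠ 0 := by omega
    -- The `n`-th Haar term turns the average over interval `n` into the averages over its two
    -- halves and changes nothing elsewhere.
    rw [Finset.sum_range_succ, ih, average, average, Finset.sum_eq_sum_Ico_succ_bot (by omega),
      show 2 * (n + 1) = 2 * n + 1 + 1 by ring, Finset.sum_Ico_succ_top (by omega),
      Finset.sum_Ico_succ_top (by omega), setIntegral_mul_haar hcd hn0 hf,
      setIntegral_dyadic hcd hn0 hf, len_two_mul hn0, len_two_mul_add_one hn0, haar_of_ne hn0]
    have hind : (dyadic c d n).indicator (1 : ℝ → ℝ) t =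
        (dyadic c d (2 * n)).indicator 1 t + (dyadic c d (2 * n + 1)).indicator 1 t := by
      have hdis := Set.disjoint_left.1 (disjoint_dyadic (c := c) (d := d) hn0)
      by_cases h1 : t ∈ dyadic c d (2 * n)
      · simp [(mem_dyadic_iff hcd hn0).2 (Or.inl h1), h1, hdis h1]
      · by_cases h2 : t ∈ dyadic c d (2 * n + 1)
        · simp [(mem_dyadic_iff hcd hn0).2 (Or.inr h2), h1, h2]
        · simp [mt (mem_dyadic_iff hcd hn0).1 (not_or.2 ⟨h1, h2⟩), h1, h2]
    rw [hind]
    have := (len_pos hcd n).ne'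
    field_simp
    ring

end Haar

/-! ### The Haar basis of `L^p` -/

namespace Haar

variable {c d : ℝ}

theorem iUnion_dyadic (hcd : c < d) {n : ℕ} (hn : 1 ≤ n) :
    ⋃ m ∈ Finset.Ico n (2 * n), dyadic c d m = Ioc c d := by
  refine Subset.antisymm (iUnion₂_subset fun m hm => dyadic_subset hcd ?_) fun t ht => ?_
  · rw [Finset.mem_Ico] at hm
    omega
  · obtain ⟨m, hm, htm⟩ := exists_mem_dyadic hcd hn ht
    exact mem_biUnion (x := m) hm htm

theorem lintegral_Ioc_eq_sum (hcd : c < d) {n : ℕ} (hn : 1 ≤ n) (g : ℝ → ℝ≥0∞) :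
    ∫⁻ t in Icc c d, g t = ∑ m ∈ Finset.Ico n (2 * n), ∫⁻ t in dyadic c d m, g t := by
  rw [← lintegral_biUnion_finset (fun m hm m' hm' hne => Set.disjoint_left.2 fun t ht ht' =>
      hne (eq_of_mem_dyadic hcd hn hm hm' ht ht')) (fun m _ => measurableSet_dyadic m),
    iUnion_dyadic hcd hn, restrict_Ioc_eq_restrict_Icc]

/-- Jensen's inequality for the average over a set of finite measure. -/
theorem enorm_average_rpow_mul_le {α : Type*} [MeasurableSpace α] {ν : Measure α} {ℓ : ℝ}
    (hℓ : 0 < ℓ) (hν : ν univ = ENNReal.ofReal ℓ) {p : ℝ≥0∞} (h1 : 1 ≤ p) (hp : p ≠ ⊤)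
    {f : α → ℝ} (hf : AEStronglyMeasurable f ν) :
    ‖(∫ t, f t ∂ν) / ℓ‖ₑ ^ p.toReal * ENNReal.ofReal ℓ ≤ ∫⁻ t, ‖f t‖ₑ ^ p.toReal ∂ν := by
  have hp0 : p ≠ 0 := (zero_lt_one.trans_le h1).ne'
  have hq : 0 < p.toReal := ENNReal.toReal_pos hp0 hp
  set q := p.toReal with hqdef
  set L := ENNReal.ofReal ℓ with hL
  have hL0 : L ≠ 0 := by simpa [hL] using hℓ
  have hLt : L ≠ ⊤ := ENNReal.ofReal_ne_top
  have h2 : ‖∫ t, f t ∂ν‖ₑ ≤ eLpNorm f p ν * L ^ (1 - 1 / q) := by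
    have h := eLpNorm_le_eLpNorm_mul_rpow_measure_univ (p := 1) (q := p) h1 hf
    rw [hν, ENNReal.toReal_one, div_one] at h
    refine (enorm_integral_le_lintegral_enorm f).trans ?_
    rwa [← eLpNorm_one_eq_lintegral_enorm]
  have h3 : ‖(∫ t, f t ∂ν) / ℓ‖ₑ ≤ eLpNorm f p ν * L ^ (- (1 / q)) := by
    rw [div_eq_mul_inv, enorm_mul, enorm_inv hℓ.ne', Real.enorm_of_nonneg hℓ.le, ← hL]
    calc ‖∫ t, f t ∂ν‖ₑ * L⁻¹ ≤ eLpNorm f p ν * L ^ (1 - 1 / q) * L⁻¹ := by gcongr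
      _ = eLpNorm f p ν * L ^ (- (1 / q)) := by
        rw [mul_assoc, ← ENNReal.rpow_neg_one, ← ENNReal.rpow_add _ _ hL0 hLt]
        congr 2
        ring
  calc ‖(∫ t, f t ∂ν) / ℓ‖ₑ ^ q * L ≤ (eLpNorm f p ν * L ^ (- (1 / q))) ^ q * L := by
        gcongr
    _ = eLpNorm f p ν ^ q := by
        rw [ENNReal.mul_rpow_of_nonneg _ _ hq.le, ← ENNReal.rpow_mul, mul_assoc]
        have : -(1 / q) * q = -1 := by field_simp
        rw [this, ENNReal.rpow_neg_one, ENNReal.inv_mul_cancel hL0 hLt, mul_one]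
    _ = ∫⁻ t, ‖f t‖ₑ ^ q ∂ν := by
        rw [eLpNorm_eq_lintegral_rpow_enorm_toReal hp0 hp, ← ENNReal.rpow_mul,
          one_div_mul_cancel hq.ne', ENNReal.rpow_one]

/-- Jensen's inequality on each cell. This bounds all partial sum operators of the Haar system by
`1`. -/
theorem eLpNorm_average_le (hcd : c < d) {p : ℝ≥0∞} (h1 : 1 ≤ p) (hp : p ≠ ⊤) {f : ℝ → ℝ}
    (hf : AEStronglyMeasurable f (intervalMeasure c d)) {n : ℕ} (hn : 1 ≤ n) :
    eLpNorm (average c d f n) p (intervalMeasure c d) ≤ eLpNorm f p (intervalMeasure c d) := by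
  have hp0 : p ≠ 0 := (zero_lt_one.trans_le h1).ne'
  have hq : 0 < p.toReal := ENNReal.toReal_pos hp0 hp
  rw [eLpNorm_eq_lintegral_rpow_enorm_toReal hp0 hp, eLpNorm_eq_lintegral_rpow_enorm_toReal hp0 hp,
    lintegral_Ioc_eq_sum hcd hn, lintegral_Ioc_eq_sum hcd hn]
  refine ENNReal.rpow_le_rpow (Finset.sum_le_sum fun m hm => ?_) (by positivity)
  have hm0 : m ≠ 0 := by
    rw [Finset.mem_Ico] at hm
    omega
  calc ∫⁻ t in dyadic c d m, ‖average c d f n t‖ₑ ^ p.toReal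
      = ∫⁻ _ in dyadic c d m, ‖(∫ s in dyadic c d m, f s) / len c d m‖ₑ ^ p.toReal :=
        setLIntegral_congr_fun (measurableSet_dyadic m) fun t ht => by
          rw [average_of_mem hcd f hn hm ht]
    _ = ‖(∫ s in dyadic c d m, f s) / len c d m‖ₑ ^ p.toReal * ENNReal.ofReal (len c d m) := by
        rw [setLIntegral_const, volume_dyadic]
    _ ≤ ∫⁻ t in dyadic c d m, ‖f t‖ₑ ^ p.toReal :=
        enorm_average_rpow_mul_le (len_pos hcd m)
          (by rw [Measure.restrict_apply_univ, volume_dyadic]) h1 hp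
          (hf.mono_measure (Measure.restrict_mono
            ((dyadic_subset hcd hm0).trans Ioc_subset_Icc_self) le_rfl))

/-- Since `m < 2^(log₂ m + 1)`, the mesh of the `n`-th partition tends to zero. -/
theorem len_le (hcd : c < d) {n m : ℕ} (hn : 1 ≤ n) (hm : n ≤ m) :
    len c d m ≤ 2 * (d - c) / n := by
  have h : (m : ℝ) < 2 ^ (Nat.log 2 m + 1) := by
    exact_mod_cast Nat.lt_pow_succ_log_self one_lt_two m
  have h' : (n : ℝ) ≤ m := by exact_mod_cast hm
  have hn0 : (0 : ℝ) < n := by exact_mod_cast hn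
  rw [len, div_le_div_iff₀ (by positivity) hn0]
  rw [pow_succ] at h
  nlinarith [sub_pos.2 hcd]

/-- Uniform continuity: on a cell shorter than `δ`, the average differs from any value by at most
`ε`. -/
theorem exists_abs_average_sub_le (hcd : c < d) {g : ℝ → ℝ} (hg : Continuous g) {ε : ℝ}
    (hε : 0 < ε) : ∃ N : ℕ, ∀ n, N ≤ n → ∀ t ∈ Ioc c d, |average c d g n t - g t| ≤ ε := by
  obtain ⟨δ, hδ, hδ'⟩ := Metric.uniformContinuousOn_iff.1
    (isCompact_Icc.uniformContinuousOn_of_continuous (hg.continuousOn (s := Icc c d))) ε hε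
  obtain ⟨N, hN⟩ := exists_nat_gt (2 * (d - c) / δ)
  refine ⟨max N 1, fun n hn t ht => ?_⟩
  have hn1 : 1 ≤ n := (le_max_right _ _).trans hn
  have hNn : (N : ℝ) ≤ n := by exact_mod_cast (le_max_left _ _).trans hn
  obtain ⟨m, hm, htm⟩ := exists_mem_dyadic hcd hn1 ht
  have hnm := (Finset.mem_Ico.1 hm).1
  have hm0 : m ≠ 0 := by omega
  have hℓ := len_pos hcd m
  have hsmall : len c d m < δ := by
    refine (len_le hcd hn1 hnm).trans_lt ?_
    have hn0 : (0 : ℝ) < n := by exact_mod_cast hn1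
    rw [div_lt_iff₀ hn0]
    have := (div_lt_iff₀ hδ).1 (hN.trans_le hNn)
    linarith
  have hsub := (dyadic_subset hcd hm0).trans Ioc_subset_Icc_self
  have hgi : IntegrableOn g (dyadic c d m) := hg.integrableOn_Icc.mono_set hsub
  have hosc : ∀ s ∈ dyadic c d m, ‖g s - g t‖ ≤ ε := fun s hs => by
    have := hδ' s (hsub hs) t (hsub htm) (by
      rw [Real.dist_eq, abs_lt]
      constructor <;> linarith [hs.1, hs.2, htm.1, htm.2])
    exact (dist_eq_norm (g s) (g t)) ▸ this.le
  have h := norm_setIntegral_le_of_norm_le_const (μ := volume) (s := dyadic c d m)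
    (by rw [volume_dyadic]; exact ENNReal.ofReal_lt_top) hosc
  rw [integral_sub hgi
    (integrableOn_const (by rw [volume_dyadic]; exact ENNReal.ofReal_ne_top)), setIntegral_const] at h
  simp only [measureReal_def, volume_dyadic, ENNReal.toReal_ofReal hℓ.le, smul_eq_mul,
    Real.norm_eq_abs] at h
  rw [average_of_mem hcd g hn1 hm htm, div_sub' hℓ.ne', abs_div, abs_of_pos hℓ, div_le_iff₀ hℓ]
  exact h

/-- The Haar functions form a Schauder basis of `L^p([c, d])`, `1 ≤ p < ∞`. -/
theorem nonempty_schauderBasis (hcd : c < d) (p : ℝ≥0∞) [Fact (1 ≤ p)] (hp : p ≠ ⊤) :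
    Nonempty (SchauderBasis ℝ (IntervalLp p c d)) := by
  have hmem : ∀ i, MemLp (haar c d i) p (intervalMeasure c d) := fun i =>
    MemLp.of_bound (measurable_haar i).aestronglyMeasurable 1
      (Filter.Eventually.of_forall (norm_haar_le hcd i))
  have hpair : ∀ i, ∃ Λ : StrongDual ℝ (IntervalLp p c d),
      ∀ u, Λ u = ∫ t in Icc c d, u t * (haar c d i t / len c d i) := fun i => by
    refine IntervalLp.exists_pairing (C := 1 / len c d i)
      ((measurable_haar i).div_const _).aestronglyMeasurable
      (Filter.Eventually.of_forall fun t => ?_)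
    rw [norm_div, Real.norm_of_nonneg (len_pos hcd i).le]
    have := len_pos hcd i
    gcongr
    exact norm_haar_le hcd i t
  choose Λ hΛ using hpair
  have hsum : ∀ (n : ℕ) (u : IntervalLp p c d), 1 ≤ n →
      (∑ i ∈ Finset.range n, Λ i u • (hmem i).toLp (haar c d i) : IntervalLp p c d)
        =ᵐ[intervalMeasure c d] average c d u n := by
    intro n u hn
    have h1 : ∀ n : ℕ,
        (∑ i ∈ Finset.range n, Λ i u • (hmem i).toLp (haar c d i) : IntervalLp p c d)
        =ᵐ[intervalMeasure c d] fun t => ∑ i ∈ Finset.range n, Λ i u * haar c d i t := by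
      intro n
      induction n with
      | zero =>
        simp only [Finset.range_zero, Finset.sum_empty]
        exact Lp.coeFn_zero _ _ _
      | succ n ih =>
        simp only [Finset.sum_range_succ]
        filter_upwards [ih, Lp.coeFn_add (∑ i ∈ Finset.range n, Λ i u • (hmem i).toLp (haar c d i))
          (Λ n u • (hmem n).toLp (haar c d n)), Lp.coeFn_smul (Λ n u) ((hmem n).toLp (haar c d n)),
          (hmem n).coeFn_toLp] with t h1 h2 h3 h4
        rw [h2, Pi.add_apply, h1, h3, Pi.smul_apply, h4, smul_eq_mul]
    have h2 : ∀ᵐ t ∂(intervalMeasure c d), t ∈ Ioc c d := by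
      rw [intervalMeasure, ← restrict_Ioc_eq_restrict_Icc]
      exact ae_restrict_mem measurableSet_Ioc
    filter_upwards [h1 n, h2] with t h1 h2
    rw [h1, ← sum_haar_eq_average hcd u.integrable hn h2]
    simp only [hΛ]
  refine SchauderBasis.exists_of_dense (fun i => (hmem i).toLp (haar c d i)) Λ ?_ (C := 1) ?_
    (BoundedContinuousFunction.toLp_denseRange ℝ (intervalMeasure c d) ℝ hp) ?_
  · intro i j
    have h1 : Λ i ((hmem j).toLp (haar c d j)) =
        (∫ t in Icc c d, haar c d j t * haar c d i t) / len c d i := by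
      rw [hΛ, ← integral_div]
      apply integral_congr_ae
      filter_upwards [(hmem j).coeFn_toLp] with t ht
      rw [ht, mul_div_assoc]
    rw [h1]
    rcases Nat.lt_trichotomy i j with h | rfl | h
    · simp only [mul_comm (haar c d j _)]
      rw [setIntegral_haar_mul_haar_of_lt hcd h, zero_div, if_neg h.ne]
    · rw [setIntegral_haar_mul_self hcd, if_pos rfl, div_self (len_pos hcd i).ne']
    · rw [setIntegral_haar_mul_haar_of_lt hcd h, zero_div, if_neg h.ne']
  · intro n u
    rcases Nat.eq_zero_or_pos n with rfl | hn
    · simp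
    · rw [one_mul, Lp.norm_def, Lp.norm_def, eLpNorm_congr_ae (hsum n u hn)]
      exact ENNReal.toReal_mono (Lp.eLpNorm_ne_top u)
        (eLpNorm_average_le hcd Fact.out hp (Lp.aestronglyMeasurable u) hn)
  · rintro _ ⟨g, rfl⟩
    set G := BoundedContinuousFunction.toLp p (intervalMeasure c d) ℝ g with hG
    have hGg : G =ᵐ[intervalMeasure c d] g := BoundedContinuousFunction.coeFn_toLp p _ ℝ g
    have hav : ∀ n t, average c d G n t = average c d g n t := fun n t => by
      refine Finset.sum_congr rfl fun m hm => ?_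
      rcases Nat.eq_zero_or_pos m with rfl | hm0
      · simp only [Finset.mem_Ico] at hm
        omega
      · congr 2
        exact integral_congr_ae (ae_restrict_of_ae_restrict_of_subset
          ((dyadic_subset hcd hm0.ne').trans Ioc_subset_Icc_self) hGg)
    rw [Metric.tendsto_atTop]
    intro ε hε
    -- `M` converts a uniform bound into an `L^p` bound.
    set M := (intervalMeasure c d).real univ ^ (p.toReal)⁻¹ with hM
    have hM0 : 0 ≤ M := by positivity
    obtain ⟨N, hN⟩ := exists_abs_average_sub_le hcd g.continuous (ε := ε / (M + 1)) (by positivity)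
    refine ⟨max N 1, fun n hn => ?_⟩
    have hn1 : 1 ≤ n := (le_max_right _ _).trans hn
    have h2 : ∀ᵐ t ∂(intervalMeasure c d), t ∈ Ioc c d := by
      rw [intervalMeasure, ← restrict_Ioc_eq_restrict_Icc]
      exact ae_restrict_mem measurableSet_Ioc
    rw [dist_eq_norm]
    have hb := Lp.norm_le_of_ae_bound (p := p) (μ := intervalMeasure c d)
      (f := (∑ i ∈ Finset.range n, Λ i G • (hmem i).toLp (haar c d i)) - G)
      (C := ε / (M + 1)) (by positivity) (by
        filter_upwards [hsum n G hn1, hGg, h2, Lp.coeFn_sub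
          (∑ i ∈ Finset.range n, Λ i G • (hmem i).toLp (haar c d i)) G] with t h1 h2 h3 h4
        rw [h4, Pi.sub_apply, h1, h2, hav]
        exact hN n ((le_max_left _ _).trans hn) t h3)
    refine hb.trans_lt ?_
    have : ((measureUnivNNReal (intervalMeasure c d) : ℝ) ^ (p.toReal)⁻¹) = M := rfl
    rw [this, mul_div_assoc', div_lt_iff₀ (by positivity)]
    nlinarith

end Haar

/-! ### Induction on the order: Schauder bases of Sobolev spaces -/

namespace SobolevSpace

variable {k : ℕ} {p : ℝ≥0∞} [Fact (1 ≤ p)] {c d : ℝ}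

theorem toLp_zero : (0 : SobolevSpace k p c d).toLp = 0 := rfl

theorem toLp_smul (a : ℝ) (u : SobolevSpace k p c d) : (a • u).toLp = a • u.toLp := rfl

/-- `W^{0,p}([c, d])` is `L^p([c, d])`. -/
theorem nonempty_zero_equiv : Nonempty (IntervalLp p c d ≃L[ℝ] SobolevSpace 0 p c d) := by
  let T : SobolevSpace 0 p c d →L[ℝ] IntervalLp p c d :=
    { toFun := fun u => u.toLp
      map_add' := fun _ _ => rfl
      map_smul' := fun _ _ => rfl
      cont := (PiLp.continuous_apply p _ 0).comp continuous_subtype_val }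
  have hker : T.ker = ⊥ := LinearMap.ker_eq_bot.2 fun u v h => ext_toLp h
  have hrange : T.range = ⊤ := by
    refine LinearMap.range_eq_top.2 fun v => ⟨⟨WithLp.toLp p fun _ => v, fun j φ _ _ _ => ?_⟩, rfl⟩
    rw [Fin.fin_one_eq_zero j]
    simp
  exact ⟨(ContinuousLinearEquiv.ofBijective T hker hrange).symm⟩

/-- The weak derivative as a bounded operator `W^{k+1,p}([c, d]) → W^{k,p}([c, d])`. -/
noncomputable def derivCLM (k : ℕ) (p : ℝ≥0∞) [Fact (1 ≤ p)] (c d : ℝ) :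
    SobolevSpace (k + 1) p c d →L[ℝ] SobolevSpace k p c d where
  toFun u := ⟨WithLp.toLp p fun j => u.wderiv j.succ, fun j => by
    have := isWeakDeriv_wderiv u 1 j (by omega)
    have hj : (⟨1 + (j : ℕ), by omega⟩ : Fin (k + 1 + 1)) = j.succ := by
      ext
      simp [add_comm]
    rw [hj] at this
    exact this⟩
  map_add' _ _ := rfl
  map_smul' _ _ := rfl
  cont := by
    refine Continuous.subtype_mk ?_ _
    exact (PiLp.continuous_toLp p _).comp (continuous_pi fun j =>
      (PiLp.continuous_apply p _ (Fin.succ j)).comp continuous_subtype_val)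

theorem toLp_derivCLM (u : SobolevSpace (k + 1) p c d) :
    (derivCLM k p c d u).toLp = u.wderiv ⟨1, by omega⟩ := by
  change u.wderiv (Fin.succ 0) = _
  congr

theorem exists_of_isWeakDeriv (v : SobolevSpace k p c d) (U : IntervalLp p c d)
    (h : IsWeakDeriv c d 1 U v.toLp) :
    ∃ u : SobolevSpace (k + 1) p c d, u.toLp = U ∧ derivCLM k p c d u = v := by
  refine ⟨⟨WithLp.toLp p (Fin.cons U fun j => v.wderiv j : Fin (k + 1 + 1) → IntervalLp p c d),
    fun j φ h1 h2 h3 => ?_⟩, rfl, Subtype.ext (PiLp.ext fun j => rfl)⟩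
  refine Fin.cases ?_ (fun i => ?_) j
  · simp
  · have e1 := h (iteratedDeriv i φ) (contDiff_iteratedDeriv_of_smooth h1 i)
      (hasCompactSupport_iteratedDeriv h2 i) ((tsupport_iteratedDeriv_subset φ i).trans h3)
    have e2 := v.2 i φ h1 h2 h3
    change ∫ t in Icc c d, U t * iteratedDeriv (i + 1) φ t =
      (-1) ^ ((i : ℕ) + 1) * ∫ t in Icc c d, v.1 i t * φ t
    rw [iteratedDeriv_succ, ← iteratedDeriv_one, e1, pow_one, pow_succ', mul_assoc, ← e2]
    rfl

/-- A preimage is the primitive from `c`, which is continuous on `[c, d]`, hence bounded and in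
`L^p`. -/
theorem derivCLM_surjective (hcd : c < d) : Function.Surjective (derivCLM k p c d) := by
  intro v
  have hv : IntegrableOn v.toLp (Icc c d) := v.toLp.integrable
  have hcont := continuousOn_primitive_of_integrableOn hcd.le hv
  obtain ⟨C, hC⟩ := isCompact_Icc.exists_bound_of_continuousOn hcont
  have hmem : MemLp (fun t => ∫ s in c..t, v.toLp s) p (intervalMeasure c d) :=
    MemLp.of_bound (hcont.aestronglyMeasurable measurableSet_Icc) C
      ((ae_restrict_iff' measurableSet_Icc).2 (Filter.Eventually.of_forall hC))
  obtain ⟨u, -, hu⟩ := exists_of_isWeakDeriv v (hmem.toLp _) fun φ h1 h2 h3 => by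
    rw [← isWeakDeriv_primitive hcd.le hv φ h1 h2 h3]
    apply integral_congr_ae
    filter_upwards [hmem.coeFn_toLp] with t ht
    rw [ht]
  exact ⟨u, hu⟩

/-- The constant functions: there is a Sobolev function equal to `1` almost everywhere. -/
theorem exists_one (hcd : c < d) : ∃ e : SobolevSpace (k + 1) p c d,
    e.toLp =ᵐ[intervalMeasure c d] (fun _ => (1 : ℝ)) ∧ derivCLM k p c d e = 0 := by
  have hmem : MemLp (fun _ : ℝ => (1 : ℝ)) p (intervalMeasure c d) := memLp_const 1
  obtain ⟨e, he, he'⟩ := exists_of_isWeakDeriv (0 : SobolevSpace k p c d) (hmem.toLp _)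
    fun φ h1 h2 h3 => by
      have e1 : ∫ t in Icc c d, hmem.toLp (fun _ => (1 : ℝ)) t * iteratedDeriv 1 φ t =
          ∫ t in c..d, deriv φ t := by
        rw [intervalIntegral.integral_of_le hcd.le, ← integral_Icc_eq_integral_Ioc]
        apply integral_congr_ae
        filter_upwards [hmem.coeFn_toLp] with t ht
        rw [ht, one_mul, iteratedDeriv_one]
      have e2 : ∫ t in Icc c d, (0 : SobolevSpace k p c d).toLp t * φ t = 0 := by
        apply integral_eq_zero_of_ae
        filter_upwards [Lp.coeFn_zero ℝ p (intervalMeasure c d)] with t ht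
        rw [toLp_zero, ht, Pi.zero_apply, zero_mul]
      have hend : ∀ t, t ∉ Ioo c d → φ t = 0 := fun t ht =>
        image_eq_zero_of_notMem_tsupport fun h => ht (h3 h)
      rw [e1, e2, mul_zero, intervalIntegral.integral_deriv_eq_sub, hend c (by simp),
        hend d (by simp), sub_zero]
      · exact fun t _ => (contDiff_infty_iff_deriv.1 h1).1 t
      · exact (contDiff_infty_iff_deriv.1 h1).2.continuous.intervalIntegrable _ _
  exact ⟨e, he ▸ hmem.coeFn_toLp, he'⟩

/-- `W^{k,p}([c, d])` has a Schauder basis, `1 ≤ p < ∞`. -/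
theorem nonempty_schauderBasis (hcd : c < d) (hp : p ≠ ⊤) :
    Nonempty (SchauderBasis ℝ (SobolevSpace k p c d)) := by
  induction k with
  | zero =>
    obtain ⟨b⟩ := Haar.nonempty_schauderBasis hcd p hp
    obtain ⟨E⟩ := nonempty_zero_equiv (p := p) (c := c) (d := d)
    exact ⟨b.mapEquiv E⟩
  | succ k ih =>
    obtain ⟨b⟩ := ih
    obtain ⟨e, he, he'⟩ := exists_one (k := k) (p := p) hcd
    refine b.exists_of_surjective (derivCLM k p c d) (derivCLM_surjective hcd) (e := e) ?_ he' ?_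
    · rintro rfl
      have h0 : ∀ᵐ _ ∂(intervalMeasure c d), False := by
        filter_upwards [he, Lp.coeFn_zero ℝ p (intervalMeasure c d)] with t h1 h2
        rw [toLp_zero, h2] at h1
        exact zero_ne_one h1
      have hne : intervalMeasure c d ≠ 0 := by
        rw [Ne, Measure.restrict_eq_zero, Real.volume_Icc, ENNReal.ofReal_eq_zero, not_le]
        linarith
      rw [Filter.eventually_false_iff_eq_bot, ae_eq_bot] at h0
      exact hne h0
    -- The kernel consists of constants, by the du Bois-Reymond lemma.
    · intro u hu
      have h1 := isWeakDeriv_wderiv u 0 1 (by omega)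
      have hz : u.wderiv ⟨1, by omega⟩ = 0 := by
        rw [← toLp_derivCLM, hu, toLp_zero]
      obtain ⟨C, hC⟩ := ae_eq_const_of_isWeakDeriv_zero hcd (u := u.toLp) u.toLp.integrable
        fun φ f1 f2 f3 => by
          have := h1 φ f1 f2 f3
          simp only [zero_add, hz] at this
          refine this.trans ?_
          congr 1
          apply integral_congr_ae
          filter_upwards [Lp.coeFn_zero ℝ p (intervalMeasure c d)] with t ht
          rw [ht]
      refine ⟨C, ext_toLp (Lp.ext ?_)⟩
      rw [toLp_smul]
      filter_upwards [hC, he, Lp.coeFn_smul C e.toLp] with t t1 t2 t3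
      rw [t1, t3, Pi.smul_apply, t2, smul_eq_mul, mul_one]

end SobolevSpace

/-! ### Gluing rescaled copies in `L^p` -/

namespace IntervalPartition

variable {c d : ℝ} {n : ℕ} (P : IntervalPartition c d n)

theorem knot_castSucc_lt_succ (i : Fin n) : P.knot i.castSucc < P.knot i.succ :=
  P.strictMono i.castSucc_lt_succ

theorem le_knot (i : Fin (n + 1)) : c ≤ P.knot i := by
  have := P.strictMono.monotone (Fin.zero_le i)
  rwa [P.first] at this

theorem knot_le (i : Fin (n + 1)) : P.knot i ≤ d := by
  have := P.strictMono.monotone (Fin.le_last i)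
  rwa [P.last] at this

theorem lt_of_fin (P : IntervalPartition c d n) (i : Fin n) : c < d :=
  (P.le_knot _).trans_lt ((P.knot_castSucc_lt_succ i).trans_le (P.knot_le _))

theorem slope_pos (i : Fin n) : 0 < P.slope i :=
  div_pos (sub_pos.2 (P.knot_castSucc_lt_succ i)) (sub_pos.2 (P.lt_of_fin i))

theorem slope_le_one (i : Fin n) : P.slope i ≤ 1 := by
  rw [slope, div_le_one (sub_pos.2 (P.lt_of_fin i))]
  linarith [P.knot_le i.succ, P.le_knot i.castSucc]

theorem piece_subset (i : Fin n) : P.piece i ⊆ Icc c d :=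
  Icc_subset_Icc (P.le_knot _) (P.knot_le _)

/-- Half-open cells form a genuine partition of `(c, d]`; the closed pieces agree with them up to
null sets. -/
theorem disjoint_cells : Pairwise (Function.onFun Disjoint fun i : Fin n =>
    Ioc (P.knot i.castSucc) (P.knot i.succ)) := by
  have key : ∀ i j : Fin n, i < j → Disjoint (Ioc (P.knot i.castSucc) (P.knot i.succ))
      (Ioc (P.knot j.castSucc) (P.knot j.succ)) := fun i j hij => by
    have : P.knot i.succ ≤ P.knot j.castSucc := P.strictMono.monotone (by
      rw [Fin.le_def]
      exact hij)
    exact Set.disjoint_left.2 fun t h h' => (h.2.trans this).not_gt h'.1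
  intro i j hij
  rcases lt_or_gt_of_ne hij with h | h
  · exact key i j h
  · exact (key j i h).symm

theorem iUnion_cells : ⋃ i : Fin n, Ioc (P.knot i.castSucc) (P.knot i.succ) = Ioc c d := by
  refine Subset.antisymm (iUnion_subset fun i => Ioc_subset_Ioc (P.le_knot _) (P.knot_le _)) ?_
  intro t ht
  have key : ∀ j : Fin (n + 1), t ≤ P.knot j →
      ∃ i : Fin n, t ∈ Ioc (P.knot i.castSucc) (P.knot i.succ) := by
    intro j
    induction j using Fin.induction with
    | zero => exact fun h => absurd (P.first ▸ h :) (not_le.2 ht.1)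
    | succ i ih =>
      intro h
      rcases le_or_gt t (P.knot i.castSucc) with h' | h'
      · exact ih h'
      · exact ⟨i, h', h⟩
  exact mem_iUnion.2 (key (Fin.last n) (P.last.symm ▸ ht.2))

theorem intervalMeasure_eq_sum :
    intervalMeasure c d = ∑ i : Fin n, volume.restrict (P.piece i) := by
  rw [intervalMeasure, ← restrict_Ioc_eq_restrict_Icc, ← P.iUnion_cells,
    Measure.restrict_iUnion P.disjoint_cells fun _ => measurableSet_Ioc, Measure.sum_fintype]
  simp only [restrict_Ioc_eq_restrict_Icc, piece]

theorem ae_iff_forall_piece {Q : ℝ → Prop} :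
    (∀ᵐ t ∂(intervalMeasure c d), Q t) ↔ ∀ i, ∀ᵐ t ∂(volume.restrict (P.piece i)), Q t := by
  rw [P.intervalMeasure_eq_sum, ← Measure.sum_fintype, Measure.ae_sum_iff]

theorem affineInv_eq (i : Fin n) :
    P.affineInv i = (fun t => t + (c - (P.slope i)⁻¹ * P.knot i.castSucc)) ∘
      fun t => (P.slope i)⁻¹ * t := by
  funext t
  simp only [affineInv, Function.comp_apply, div_eq_mul_inv]
  ring

theorem measurableEmbedding_affineInv (i : Fin n) : MeasurableEmbedding (P.affineInv i) := by
  rw [P.affineInv_eq i]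
  exact (Homeomorph.addRight _).measurableEmbedding.comp
    (Homeomorph.mulLeft₀ _ (inv_ne_zero (P.slope_pos i).ne')).measurableEmbedding

theorem affineInv_preimage (i : Fin n) : P.affineInv i ⁻¹' Icc c d = P.piece i := by
  ext t
  have ha := P.slope_pos i
  have hd : d - c = (P.knot i.succ - P.knot i.castSucc) / P.slope i := by
    rw [slope]
    have := sub_pos.2 (P.knot_castSucc_lt_succ i)
    field_simp
  simp only [mem_preimage, affineInv, mem_Icc, piece]
  rw [le_add_iff_nonneg_right, le_div_iff₀ ha, zero_mul, ← le_sub_iff_add_le', hd,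
    div_le_div_iff_of_pos_right ha, sub_nonneg, sub_le_sub_iff_right]

/-- The change of variables behind every norm and integral formula for gluing; it produces the
factor `a_i`. -/
theorem map_affineInv (i : Fin n) :
    Measure.map (P.affineInv i) (volume.restrict (P.piece i)) =
      ENNReal.ofReal (P.slope i) • intervalMeasure c d := by
  rw [← P.affineInv_preimage i, ← (P.measurableEmbedding_affineInv i).restrict_map, P.affineInv_eq,
    ← Measure.map_map (measurable_add_const _) (measurable_const_mul _),
    Real.map_volume_mul_left (inv_ne_zero (P.slope_pos i).ne'), Measure.map_smul,
    map_add_right_eq_self, Measure.restrict_smul, inv_inv, abs_of_pos (P.slope_pos i)]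

theorem ae_comp_affineInv {Q : ℝ → Prop} (h : ∀ᵐ t ∂(intervalMeasure c d), Q t) (i : Fin n) :
    ∀ᵐ t ∂(volume.restrict (P.piece i)), Q (P.affineInv i t) := by
  refine ae_of_ae_map (P.measurableEmbedding_affineInv i).measurable.aemeasurable ?_
  rw [P.map_affineInv i]
  exact Measure.ae_smul_measure h _

/-- The function equal to `β_i v ∘ L_i⁻¹` on the `i`-th subinterval. -/
noncomputable def glue (β : Fin n → ℝ) (v : ℝ → ℝ) (t : ℝ) : ℝ :=
  ∑ i, (Ioc (P.knot i.castSucc) (P.knot i.succ)).indicator (fun t => β i * v (P.affineInv i t)) t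

theorem measurable_glue (β : Fin n → ℝ) {v : ℝ → ℝ} (hv : Measurable v) :
    Measurable (P.glue β v) := by
  unfold glue
  exact Finset.measurable_fun_sum _ fun i _ => ((hv.comp
    (P.measurableEmbedding_affineInv i).measurable).const_mul _).indicator measurableSet_Ioc

theorem glue_ae_eq (β : Fin n → ℝ) (v : ℝ → ℝ) (i : Fin n) :
    ∀ᵐ t ∂(volume.restrict (P.piece i)), P.glue β v t = β i * v (P.affineInv i t) := by
  rw [piece, ← restrict_Ioc_eq_restrict_Icc]
  filter_upwards [ae_restrict_mem measurableSet_Ioc] with t ht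
  rw [glue, Finset.sum_eq_single i, indicator_of_mem ht]
  · intro j _ hj
    exact indicator_of_notMem (Set.disjoint_left.1 (P.disjoint_cells hj.symm) ht) _
  · exact fun h => absurd (Finset.mem_univ i) h

theorem lintegral_glue (β : Fin n → ℝ) (v : ℝ → ℝ) {q : ℝ} (hq : 0 ≤ q) :
    ∫⁻ t in Icc c d, ‖P.glue β v t‖ₑ ^ q =
      ENNReal.ofReal (∑ i, |β i| ^ q * P.slope i) * ∫⁻ t in Icc c d, ‖v t‖ₑ ^ q := by
  have hμ := P.intervalMeasure_eq_sum
  rw [intervalMeasure] at hμ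
  conv_lhs => rw [hμ]
  rw [lintegral_finsetSum_measure, ENNReal.ofReal_sum_of_nonneg fun i _ =>
    mul_nonneg (by positivity) (P.slope_pos i).le, Finset.sum_mul]
  refine Finset.sum_congr rfl fun i _ => ?_
  have h1 : ∫⁻ t in P.piece i, ‖P.glue β v t‖ₑ ^ q =
      ∫⁻ t in P.piece i, (fun s => ‖β i‖ₑ ^ q * ‖v s‖ₑ ^ q) (P.affineInv i t) := by
    apply lintegral_congr_ae
    filter_upwards [P.glue_ae_eq β v i] with t ht
    rw [ht, enorm_mul, ENNReal.mul_rpow_of_nonneg _ _ hq]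
  refine (h1.trans ((P.measurableEmbedding_affineInv i).lintegral_map
    (fun s => ‖β i‖ₑ ^ q * ‖v s‖ₑ ^ q)).symm).trans ?_
  rw [P.map_affineInv,
    lintegral_smul_measure, lintegral_const_mul' _ _
      (ENNReal.rpow_ne_top_of_nonneg hq enorm_ne_top), smul_eq_mul, ← mul_assoc,
    ENNReal.ofReal_mul (by positivity), ← ENNReal.ofReal_rpow_of_nonneg (abs_nonneg _) hq,
    ← Real.enorm_eq_ofReal_abs, mul_comm (ENNReal.ofReal _)]

theorem eLpNorm_glue (β : Fin n → ℝ) (v : ℝ → ℝ) {p : ℝ≥0∞} (h1 : 1 ≤ p) (hp : p ≠ ⊤) :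
    eLpNorm (P.glue β v) p (intervalMeasure c d) =
      ENNReal.ofReal ((∑ i, |β i| ^ p.toReal * P.slope i) ^ (1 / p.toReal)) *
        eLpNorm v p (intervalMeasure c d) := by
  have hp0 : p ≠ 0 := (zero_lt_one.trans_le h1).ne'
  have hs : 0 ≤ ∑ i, |β i| ^ p.toReal * P.slope i :=
    Finset.sum_nonneg fun i _ => mul_nonneg (by positivity) (P.slope_pos i).le
  rw [eLpNorm_eq_lintegral_rpow_enorm_toReal hp0 hp, eLpNorm_eq_lintegral_rpow_enorm_toReal hp0 hp,
    P.lintegral_glue β v ENNReal.toReal_nonneg, ENNReal.mul_rpow_of_nonneg _ _ (by positivity),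
    ENNReal.ofReal_rpow_of_nonneg hs (by positivity)]

variable {p : ℝ≥0∞} [Fact (1 ≤ p)]

theorem memLp_glue (hp : p ≠ ⊤) (β : Fin n → ℝ) (v : IntervalLp p c d) :
    MemLp (P.glue β v) p (intervalMeasure c d) := by
  refine ⟨(P.measurable_glue β (Lp.stronglyMeasurable v).measurable).aestronglyMeasurable, ?_⟩
  rw [P.eLpNorm_glue β v Fact.out hp]
  exact ENNReal.mul_lt_top ENNReal.ofReal_lt_top (Lp.eLpNorm_lt_top v)

/-- The operator `v ↦ β_i v ∘ L_i⁻¹` (on the `i`-th subinterval) on `L^p([c, d])`. -/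
noncomputable def glueCLM (hp : p ≠ ⊤) (β : Fin n → ℝ) : IntervalLp p c d →L[ℝ] IntervalLp p c d :=
  LinearMap.mkContinuous
    { toFun := fun v => (P.memLp_glue hp β v).toLp _
      map_add' := fun u v => by
        apply Lp.ext
        refine P.ae_iff_forall_piece.2 fun i => ?_
        filter_upwards [P.ae_iff_forall_piece.1 (P.memLp_glue hp β (u + v)).coeFn_toLp i,
          P.ae_iff_forall_piece.1 (P.memLp_glue hp β u).coeFn_toLp i,
          P.ae_iff_forall_piece.1 (P.memLp_glue hp β v).coeFn_toLp i,
          P.ae_iff_forall_piece.1 (Lp.coeFn_add ((P.memLp_glue hp β u).toLp _)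
            ((P.memLp_glue hp β v).toLp _)) i,
          P.ae_comp_affineInv (Lp.coeFn_add u v) i, P.glue_ae_eq β (u + v : IntervalLp p c d) i,
          P.glue_ae_eq β u i, P.glue_ae_eq β v i] with t h1 h2 h3 h4 h5 h6 h7 h8
        rw [h4, Pi.add_apply, h1, h2, h3, h6, h7, h8, h5, Pi.add_apply, mul_add]
      map_smul' := fun a v => by
        apply Lp.ext
        refine P.ae_iff_forall_piece.2 fun i => ?_
        filter_upwards [P.ae_iff_forall_piece.1 (P.memLp_glue hp β (a • v)).coeFn_toLp i,
          P.ae_iff_forall_piece.1 (P.memLp_glue hp β v).coeFn_toLp i,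
          P.ae_iff_forall_piece.1 (Lp.coeFn_smul a ((P.memLp_glue hp β v).toLp _)) i,
          P.ae_comp_affineInv (Lp.coeFn_smul a v) i, P.glue_ae_eq β (a • v : IntervalLp p c d) i,
          P.glue_ae_eq β v i] with t h1 h2 h3 h4 h5 h6
        rw [RingHom.id_apply, h3, Pi.smul_apply, h1, h2, h5, h6, h4, Pi.smul_apply, smul_eq_mul,
          smul_eq_mul, mul_left_comm] }
    ((∑ i, |β i| ^ p.toReal * P.slope i) ^ (1 / p.toReal))
    fun v => by
      have hs : 0 ≤ ∑ i, |β i| ^ p.toReal * P.slope i :=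
        Finset.sum_nonneg fun i _ => mul_nonneg (by positivity) (P.slope_pos i).le
      change ‖(P.memLp_glue hp β v).toLp _‖ ≤ _
      rw [Lp.norm_toLp, P.eLpNorm_glue β v Fact.out hp, ENNReal.toReal_mul,
        ENNReal.toReal_ofReal (by positivity), ← Lp.norm_def]

theorem norm_glueCLM_le (hp : p ≠ ⊤) (β : Fin n → ℝ) (v : IntervalLp p c d) :
    ‖P.glueCLM hp β v‖ ≤ (∑ i, |β i| ^ p.toReal * P.slope i) ^ (1 / p.toReal) * ‖v‖ := by
  have hs : 0 ≤ ∑ i, |β i| ^ p.toReal * P.slope i :=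
    Finset.sum_nonneg fun i _ => mul_nonneg (by positivity) (P.slope_pos i).le
  exact (P.glueCLM hp β).le_of_opNorm_le (LinearMap.mkContinuous_norm_le _ (by positivity) _) v

theorem glueCLM_ae_eq (hp : p ≠ ⊤) (β : Fin n → ℝ) (v : IntervalLp p c d) (i : Fin n) :
    ∀ᵐ t ∂(volume.restrict (P.piece i)),
      P.glueCLM hp β v t = β i * v (P.affineInv i t) := by
  filter_upwards [P.ae_iff_forall_piece.1 (P.memLp_glue hp β v).coeFn_toLp i,
    P.glue_ae_eq β v i] with t h1 h2
  rw [← h2, ← h1]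
  rfl

/-- The transpose of gluing: it moves the affine maps onto the test function. -/
theorem integral_glueCLM_mul (hp : p ≠ ⊤) (β : Fin n → ℝ) (v : IntervalLp p c d) {ψ : ℝ → ℝ}
    (hψ : Continuous ψ) : ∫ t in Icc c d, P.glueCLM hp β v t * ψ t =
      ∑ i, β i * P.slope i *
        ∫ t in Icc c d, v t * ψ (P.knot i.castSucc + P.slope i * (t - c)) := by
  have hint := (P.glueCLM hp β v).integrable_mul_of_continuous hψ
  have hμ := P.intervalMeasure_eq_sum
  rw [intervalMeasure] at hμ
  conv_lhs => rw [hμ]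
  rw [integral_finsetSum_measure fun i _ =>
    hint.mono_measure (Measure.restrict_mono (P.piece_subset i) le_rfl)]
  refine Finset.sum_congr rfl fun i _ => ?_
  have h1 : ∫ t in P.piece i, P.glueCLM hp β v t * ψ t =
      ∫ t in P.piece i, (fun s => β i * (v s * ψ (P.knot i.castSucc + P.slope i * (s - c))))
        (P.affineInv i t) := by
    apply integral_congr_ae
    filter_upwards [P.glueCLM_ae_eq hp β v i] with t ht
    have : P.knot i.castSucc + P.slope i * (P.affineInv i t - c) = t := by
      have := (P.slope_pos i).ne'
      rw [affineInv]
      field_simp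
      ring
    simp only [this]
    rw [ht, mul_assoc]
  refine (h1.trans ((P.measurableEmbedding_affineInv i).integral_map
    (fun s => β i * (v s * ψ (P.knot i.castSucc + P.slope i * (s - c))))).symm).trans ?_
  rw [P.map_affineInv,
    integral_smul_measure, integral_const_mul, ENNReal.toReal_ofReal (P.slope_pos i).le,
    smul_eq_mul]
  ring

end IntervalPartition

/-! ### Gluing Sobolev tuples -/

theorem iteratedDeriv_comp_affine {φ : ℝ → ℝ} (hφ : ContDiff ℝ (⊤ : ℕ∞) φ) (a b c : ℝ) (j : ℕ)
    (t : ℝ) : iteratedDeriv j (fun s => φ (b + a * (s - c))) t =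
      a ^ j * iteratedDeriv j φ (b + a * (t - c)) := by
  induction j generalizing t with
  | zero => simp
  | succ j ih =>
    rw [iteratedDeriv_succ, funext ih, iteratedDeriv_succ]
    have h1 : HasDerivAt (fun s : ℝ => b + a * (s - c)) a t := by
      simpa using (((hasDerivAt_id t).sub_const c).const_mul a).const_add b
    have h2 : HasDerivAt (iteratedDeriv j φ) (deriv (iteratedDeriv j φ) (b + a * (t - c)))
        (b + a * (t - c)) :=
      ((contDiff_infty_iff_deriv.1 (contDiff_iteratedDeriv_of_smooth hφ j)).1 _).hasDerivAt
    have h3 := (h2.comp t h1).const_mul (a ^ j)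
    refine h3.deriv.trans ?_
    rw [pow_succ]
    ring

namespace IntervalPartition

variable {c d : ℝ} {n : ℕ} (P : IntervalPartition c d n) {k : ℕ} {p : ℝ≥0∞}

theorem scaleConst_nonneg (α : Fin n → ℝ) : 0 ≤ P.scaleConst k p α := by
  refine Real.rpow_nonneg (Finset.sum_nonneg fun i _ => ?_) _
  have := P.slope_pos i
  positivity

/-- The left side is the norm bound for the `j`-th derivative, with summands `|α_i|^p / a_i^(j p -
1)`. They increase with `j` because `a_i ≤ 1`, so the top order `k` dominates. -/
theorem sum_rpow_le_scaleConst (α : Fin n → ℝ) {j : ℕ} (hj : j ≤ k) :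
    (∑ i, |α i / P.slope i ^ j| ^ p.toReal * P.slope i) ^ (1 / p.toReal) ≤ P.scaleConst k p α := by
  unfold scaleConst
  have hnn : ∀ i, 0 ≤ |α i / P.slope i ^ j| ^ p.toReal * P.slope i := fun i =>
    mul_nonneg (by positivity) (P.slope_pos i).le
  refine Real.rpow_le_rpow (Finset.sum_nonneg fun i _ => hnn i)
    (Finset.sum_le_sum fun i _ => ?_) (by positivity)
  have ha := P.slope_pos i
  have h1 : |α i / P.slope i ^ j| ^ p.toReal * P.slope i =
      |α i| ^ p.toReal / P.slope i ^ ((j : ℝ) * p.toReal - 1) := by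
    rw [abs_div, abs_of_pos (pow_pos ha j), Real.div_rpow (abs_nonneg _) (by positivity),
      ← Real.rpow_natCast, ← Real.rpow_mul ha.le, Real.rpow_sub ha, Real.rpow_one, div_div_eq_mul_div,
      div_mul_eq_mul_div]
  rw [h1]
  have hjk : (j : ℝ) ≤ k := by exact_mod_cast hj
  refine div_le_div_of_nonneg_left (by positivity) (by positivity) ?_
  refine Real.rpow_le_rpow_of_exponent_ge ha (P.slope_le_one i) ?_
  gcongr

variable [Fact (1 ≤ p)]

/-- The operator which maps `(v_0, …, v_k)` to the tuple with `j`-th entry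
`α_i a_i^{-j} v_j ∘ L_i⁻¹` on the `i`-th subinterval. -/
noncomputable def glueTuple (hp : p ≠ ⊤) (k : ℕ) (α : Fin n → ℝ) :
    PiLp p (fun _ : Fin (k + 1) => IntervalLp p c d) →L[ℝ]
      PiLp p (fun _ : Fin (k + 1) => IntervalLp p c d) :=
  LinearMap.mkContinuous
    { toFun := fun v =>
        WithLp.toLp p fun j => P.glueCLM hp (fun i => α i / P.slope i ^ (j : ℕ)) (v j)
      map_add' := fun u v => PiLp.ext fun j => (P.glueCLM hp _).map_add (u j) (v j)
      map_smul' := fun a v => PiLp.ext fun j => (P.glueCLM hp _).map_smul a (v j) }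
    (P.scaleConst k p α) fun v => by
      have hq : 0 < p.toReal :=
        ENNReal.toReal_pos (zero_lt_one.trans_le (Fact.out : 1 ≤ p)).ne' hp
      have hK := P.scaleConst_nonneg (k := k) (p := p) α
      rw [PiLp.norm_eq_sum hq, PiLp.norm_eq_sum hq]
      calc (∑ j : Fin (k + 1),
            ‖P.glueCLM hp (fun i => α i / P.slope i ^ (j : ℕ)) (v j)‖ ^ p.toReal) ^ (1 / p.toReal)
          ≤ (∑ j : Fin (k + 1), (P.scaleConst k p α * ‖v j‖) ^ p.toReal) ^ (1 / p.toReal) := by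
            gcongr with j
            refine (P.norm_glueCLM_le hp _ _).trans ?_
            gcongr
            exact P.sum_rpow_le_scaleConst α (Nat.lt_succ_iff.1 j.2)
        _ = P.scaleConst k p α * (∑ j : Fin (k + 1), ‖v j‖ ^ p.toReal) ^ (1 / p.toReal) := by
            simp only [Real.mul_rpow hK (norm_nonneg _)]
            rw [← Finset.mul_sum, Real.mul_rpow (by positivity) (by positivity), ← Real.rpow_mul hK,
              mul_one_div_cancel hq.ne', Real.rpow_one]

theorem norm_glueTuple_le (hp : p ≠ ⊤) (α : Fin n → ℝ) :
    ‖P.glueTuple hp k α‖ ≤ P.scaleConst k p α :=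
  LinearMap.mkContinuous_norm_le _ (P.scaleConst_nonneg α) _

theorem glueTuple_apply (hp : p ≠ ⊤) (α : Fin n → ℝ)
    (v : PiLp p (fun _ : Fin (k + 1) => IntervalLp p c d)) (j : Fin (k + 1)) :
    P.glueTuple hp k α v j = P.glueCLM hp (fun i => α i / P.slope i ^ (j : ℕ)) (v j) := rfl

theorem glueTuple_apply_zero (hp : p ≠ ⊤) (α : Fin n → ℝ)
    (v : PiLp p (fun _ : Fin (k + 1) => IntervalLp p c d)) :
    P.glueTuple hp k α v 0 = P.glueCLM hp α (v 0) := by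
  rw [glueTuple_apply]
  simp

/-- The transposed test function is `φ ∘ L_i`, whose `j`-th derivative carries a factor `a_i^j` that
cancels the weight `a_i^{-j}`. It need not vanish at `c` or `d`, which is why membership is tested
with all smooth functions. -/
theorem glueTuple_mem (hp : p ≠ ⊤) (α : Fin n → ℝ)
    {v : PiLp p (fun _ : Fin (k + 1) => IntervalLp p c d)} (hv : v ∈ sobolevZeroSubmodule k p c d) :
    P.glueTuple hp k α v ∈ sobolevZeroSubmodule k p c d := by
  intro j φ hφ
  rw [glueTuple_apply_zero, glueTuple_apply,
    P.integral_glueCLM_mul hp _ _ (continuous_iteratedDeriv_of_smooth hφ j),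
    P.integral_glueCLM_mul hp _ _ hφ.continuous, Finset.mul_sum]
  refine Finset.sum_congr rfl fun i _ => ?_
  have ha := (P.slope_pos i).ne'
  have h := hv j (fun s => φ (P.knot i.castSucc + P.slope i * (s - c)))
    (hφ.comp (contDiff_const.add (contDiff_const.mul (contDiff_id.sub contDiff_const))))
  simp only [iteratedDeriv_comp_affine hφ, mul_left_comm _ (P.slope i ^ (j : ℕ))] at h
  rw [integral_const_mul] at h
  rw [mul_left_comm, ← h]
  field_simp

/-- The partial sums of the Neumann series stay in an invariant subspace, and it is closed. -/
theorem glueTuple_resolvent_mem (hp : p ≠ ⊤) (α : Fin n → ℝ) (hK : P.scaleConst k p α < 1)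
    {v : PiLp p (fun _ : Fin (k + 1) => IntervalLp p c d)} (hv : v ∈ sobolevZeroSubmodule k p c d) :
    (∑' m : ℕ, P.glueTuple hp k α ^ m) v ∈ sobolevZeroSubmodule k p c d := by
  have hs : Summable fun m : ℕ => P.glueTuple hp k α ^ m :=
    summable_geometric_of_norm_lt_one ((P.norm_glueTuple_le hp α).trans_lt hK)
  have h := (hs.hasSum.mapL (ContinuousLinearMap.apply ℝ _ v))
  refine isClosed_sobolevZeroSubmodule.mem_of_tendsto h (Filter.Eventually.of_forall fun s => ?_)
  refine Submodule.sum_mem _ fun m hm => ?_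
  clear hm
  change (P.glueTuple hp k α ^ m) v ∈ _
  induction m with
  | zero => simpa using hv
  | succ m ih =>
    rw [pow_succ']
    exact P.glueTuple_mem hp α ih

end IntervalPartition

/-! ### The fractal operator -/

section Fractal

variable {c d : ℝ} {n : ℕ} {k : ℕ} {p : ℝ≥0∞} [Fact (1 ≤ p)]

/-- The a.e. equations on the pieces become one equation in `L^p`; only the zeroth component of the
tuple enters. -/
theorem isAlphaFractal_iff (P : IntervalPartition c d n) (hp : p ≠ ⊤) (α : Fin n → ℝ)
    (f b g : SobolevSpace k p c d) :
    IsAlphaFractal P α f b g ↔ g.toLp = f.toLp + P.glueCLM hp α (g.toLp - b.toLp) := by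
  have key : ∀ i, ∀ᵐ t ∂(volume.restrict (P.piece i)),
      (f.toLp + P.glueCLM hp α (g.toLp - b.toLp) : IntervalLp p c d) t =
        f.toLp t + α i * (g.toLp (P.affineInv i t) - b.toLp (P.affineInv i t)) := fun i => by
    filter_upwards [P.ae_iff_forall_piece.1 (Lp.coeFn_add f.toLp
      (P.glueCLM hp α (g.toLp - b.toLp))) i, P.glueCLM_ae_eq hp α (g.toLp - b.toLp) i,
      P.ae_comp_affineInv (Lp.coeFn_sub g.toLp b.toLp) i] with t h1 h2 h3
    rw [h1, Pi.add_apply, h2, h3, Pi.sub_apply]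
  constructor
  · intro h
    refine Lp.ext (P.ae_iff_forall_piece.2 fun i => ?_)
    filter_upwards [h i, key i] with t h1 h2
    rw [h1, h2]
  · intro h i
    filter_upwards [key i] with t h1
    rw [← h1, ← h]

/-- Fractal functions with the same data coincide. -/
theorem IsAlphaFractal.unique {P : IntervalPartition c d n} (hp : p ≠ ⊤) {α : Fin n → ℝ}
    (hK : P.scaleConst k p α < 1) {f b g g' : SobolevSpace k p c d}
    (h : IsAlphaFractal P α f b g) (h' : IsAlphaFractal P α f b g') : g = g' := by
  rw [isAlphaFractal_iff P hp] at h h'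
  have hd : g.toLp - g'.toLp = P.glueCLM hp α (g.toLp - g'.toLp) := by
    conv_lhs => rw [h, h']
    rw [add_sub_add_left_eq_sub, ← map_sub, sub_sub_sub_cancel_right]
  -- The bound for `j = 0` makes gluing a contraction of `L^p` with constant `K < 1`.
  have hle : ‖g.toLp - g'.toLp‖ ≤ P.scaleConst k p α * ‖g.toLp - g'.toLp‖ := by
    conv_lhs => rw [hd]
    refine (P.norm_glueCLM_le hp α _).trans ?_
    gcongr
    simpa using P.sum_rpow_le_scaleConst (k := k) (p := p) α (Nat.zero_le k)
  have h0 : ‖g.toLp - g'.toLp‖ = 0 := by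
    have := norm_nonneg (g.toLp - g'.toLp)
    nlinarith
  exact SobolevSpace.ext_toLp (sub_eq_zero.1 (norm_eq_zero.1 h0))

/-- The `α`-fractal operator is a topological automorphism of the Sobolev space. -/
theorem exists_fractalEquiv (hcd : c < d) (hp : p ≠ ⊤) (P : IntervalPartition c d n)
    (L : SobolevSpace k p c d →L[ℝ] SobolevSpace k p c d)
    (hL : ∀ f : SobolevSpace k p c d, SobolevSpace.EqAtEndpoints (L f) f) (α : Fin n → ℝ)
    (hα : P.scaleConst k p α < (1 + ‖ContinuousLinearMap.id ℝ (SobolevSpace k p c d) - L‖)⁻¹) :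
    ∃ F : SobolevSpace k p c d ≃L[ℝ] SobolevSpace k p c d,
      ∀ f g : SobolevSpace k p c d, IsAlphaFractal P α f (L f) g ↔ g = F f := by
  set D := ContinuousLinearMap.id ℝ (SobolevSpace k p c d) - L with hD
  set K := P.scaleConst k p α with hKdef
  have hK0 : 0 ≤ K := P.scaleConst_nonneg α
  have hD0 : 0 ≤ ‖D‖ := norm_nonneg D
  have hmul : K * (1 + ‖D‖) < 1 := (lt_div_iff₀ (by positivity)).1 (by rwa [one_div])
  have hK1 : K < 1 := by nlinarith
  set S := P.glueTuple hp k α with hS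
  have hSK : ‖S‖ ≤ K := P.norm_glueTuple_le hp α
  -- `R = (1 - S)⁻¹` as a Neumann series, on the full product of `L^p` spaces.
  set R := ∑' m : ℕ, S ^ m with hR
  have hSR : ∀ v, R v - S (R v) = v := fun v => by
    have := congrArg (fun T => T v) (mul_neg_geom_series S (hSK.trans_lt hK1))
    simpa [sub_mul] using this
  have hRn : ‖R‖ ≤ (1 - K)⁻¹ := by
    have h1 := tsum_geometric_le_of_norm_lt_one S (hSK.trans_lt hK1)
    -- The geometric bound in `h1` carries an extra `‖1‖ - 1`, which is at most zero.
    have h2 : ‖(1 : PiLp p (fun _ : Fin (k + 1) => IntervalLp p c d) →L[ℝ]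
      PiLp p (fun _ : Fin (k + 1) => IntervalLp p c d))‖ ≤ 1 := ContinuousLinearMap.norm_id_le
    have h3 : (1 - ‖S‖)⁻¹ ≤ (1 - K)⁻¹ := by
      have : 0 < 1 - K := by linarith
      gcongr
    linarith
  have hDmem : ∀ f, ((D f : SobolevSpace k p c d) :
      PiLp p (fun _ : Fin (k + 1) => IntervalLp p c d)) ∈ sobolevZeroSubmodule k p c d := fun f => by
    have := (sobolevZeroSubmodule k p c d).neg_mem ((hL f).sub_mem hcd)
    rwa [← Submodule.coe_neg, neg_sub] at this
  let B : SobolevSpace k p c d →L[ℝ] SobolevSpace k p c d :=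
    (S.comp (R.comp ((sobolevSubmodule k p c d).subtypeL.comp D))).codRestrict _ fun f =>
      sobolevZeroSubmodule_le (P.glueTuple_mem hp α
        (P.glueTuple_resolvent_mem hp α hK1 (hDmem f)))
  have hBapply : ∀ f, ((B f : SobolevSpace k p c d) :
      PiLp p (fun _ : Fin (k + 1) => IntervalLp p c d)) = S (R (D f : SobolevSpace k p c d)) :=
    fun f => rfl
  have hBn : ‖B‖ ≤ K * ((1 - K)⁻¹ * ‖D‖) := by
    refine ContinuousLinearMap.opNorm_le_bound _ ?_ fun f => ?_
    · have : 0 < 1 - K := by linarith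
      positivity
    · calc ‖B f‖ = ‖S (R (D f : SobolevSpace k p c d))‖ := rfl
        _ ≤ K * ((1 - K)⁻¹ * (‖D‖ * ‖f‖)) := by
          refine (S.le_of_opNorm_le hSK _).trans ?_
          gcongr
          refine (R.le_of_opNorm_le hRn _).trans ?_
          have : 0 < 1 - K := by linarith
          gcongr
          exact D.le_opNorm f
        _ = K * ((1 - K)⁻¹ * ‖D‖) * ‖f‖ := by ring
  -- `K ‖D‖ / (1 - K) < 1` is `K (1 + ‖D‖) < 1`, the hypothesis on `α`.
  have hB1 : ‖-B‖ < 1 := by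
    refine ((norm_neg B).le.trans hBn).trans_lt ?_
    have : 0 < 1 - K := by linarith
    rw [mul_left_comm, inv_mul_lt_iff₀ this]
    linarith
  let F : SobolevSpace k p c d ≃L[ℝ] SobolevSpace k p c d :=
    ContinuousLinearEquiv.ofUnit (Units.oneSub (-B) hB1)
  have hF : ∀ f, F f = f + B f := fun f => by
    change ((1 : SobolevSpace k p c d →L[ℝ] SobolevSpace k p c d) - -B) f = _
    simp
  have hfix : ∀ f, IsAlphaFractal P α f (L f) (F f) := fun f => by
    rw [isAlphaFractal_iff P hp, hF]
    set w := R (D f : SobolevSpace k p c d) with hw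
    -- `F f - L f = D f + S w = w` by the resolvent identity, so the glued term in the equation is
    -- `S w`, which is `B f`.
    have h1 : ((f + B f - L f : SobolevSpace k p c d) :
        PiLp p (fun _ : Fin (k + 1) => IntervalLp p c d)) = w := by
      have e1 : f + B f - L f = D f + B f := by
        rw [hD]
        simp only [_root_.sub_apply, ContinuousLinearMap.id_apply]
        abel
      rw [e1, Submodule.coe_add, hBapply, ← hw]
      have := hSR (D f : SobolevSpace k p c d)
      rw [← hw] at this
      rw [← this, sub_add_cancel]
    have h2 : (f + B f).toLp - (L f).toLp = w 0 := congrArg (fun u => u 0) h1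
    rw [h2, ← P.glueTuple_apply_zero hp α w]
    rfl
  exact ⟨F, fun f g => ⟨fun h => h.unique hp hK1 (hfix f), fun h => h ▸ hfix f⟩⟩

end Fractal

theorem mainTheorem1 {c d : ℝ} (k : ℕ) (p : ℝ≥0∞) [Fact (1 ≤ p)] (hp : p ≠ ⊤)
    (n : ℕ) (hn : 2 ≤ n) (P : IntervalPartition c d n)
    (L : SobolevSpace k p c d →L[ℝ] SobolevSpace k p c d)
    (hL : ∀ f : SobolevSpace k p c d, SobolevSpace.EqAtEndpoints (L f) f)
    (α : Fin n → ℝ)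
    (hα : P.scaleConst k p α < (1 + ‖ContinuousLinearMap.id ℝ (SobolevSpace k p c d) - L‖)⁻¹) :
    ∃ F : SobolevSpace k p c d ≃L[ℝ] SobolevSpace k p c d,
      (∀ f g : SobolevSpace k p c d, IsAlphaFractal P α f (L f) g ↔ g = F f) ∧
      (∀ e : SchauderBasis ℝ (SobolevSpace k p c d),
        ∃ e' : SchauderBasis ℝ (SobolevSpace k p c d), ∀ m, e' m = F (e m)) ∧
      (∃ e e' : SchauderBasis ℝ (SobolevSpace k p c d),
        ∀ m, IsAlphaFractal P α (e m) (L (e m)) (e' m)) := by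
  have hcd : c < d := P.lt_of_fin ⟨0, by omega⟩
  obtain ⟨F, hF⟩ := exists_fractalEquiv hcd hp P L hL α hα
  obtain ⟨e⟩ := SobolevSpace.nonempty_schauderBasis (k := k) hcd hp
  exact ⟨F, hF, fun e => ⟨e.mapEquiv F, fun _ => rfl⟩,
    e, e.mapEquiv F, fun m => (hF (e m) _).2 rfl⟩
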